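/- Let $d\ge 2$. For bounded Lipschitz domains $\mathcal U,\Omega\subset\mathbb R^d$ with $\overline{\mathcal U}\subset\Omega$ put $\omega=\Omega\setminus\overline{\mathcal U}$, let $\gamma_0\colon H^1(\omega)\to L^2(\partial\omega)$ be the trace operator, and for a vector field $n$ on $\omega$, $\alpha\ge0$ and $\varepsilon>0$ let $$a_\varepsilon(u,v)=\int_\Omega(\nabla u\cdot\nabla v+uv)\,dx+\frac1\varepsilon\int_\omega\bigl((\nabla u\cdot n)\,v+\alpha uv\bigr)\,dx,\qquad u,v\in H^1_0(\Omega),$$ be the bilinear form of the penalized problem: find $u_\varepsilon\in H^1_0(\Omega)$ with $a_\varepsilon(u_\varepsilon,\varphi)=\int_{\mathcal U} f\varphi+\frac1\varepsilon\int_\omega g\varphi$ for all $\varphi\in H^1_0(\Omega)$. The form $a_\varepsilon$ is called coercive if there is $c>0$ with $a_\varepsilon(u,u)\ge c\|u\|_{H^1(\Omega)}^2$ for all $u\in H^1_0(\Omega)$. Then the following hold. 1. (The trace is not controlled by the $L^2(\omega)$ norm.) Let $\mathcal U,\Omega$ be bounded Lipschitz domains with $\overline{\mathcal U}\subset\Omega$,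 and let $\omega_j=\{x\in\omega:\ d(x,\partial\mathcal U)<1/\sqrt j\}$. For all sufficiently large $j$ there is a function $f_j\in H^1_0(\Omega)$ with $f_j=1$ in $\mathcal U$, with $f_j(x)=\dfrac1{1+j\,d(x,\partial\mathcal U)}$ for $x\in\omega_j$, and with $f_j$ (weakly) harmonic in $\omega\setminus\overline{\omega_j}$, such that the trace of $f_j$ from $\omega$ is $1$ on $\partial\mathcal U$ and $0$ on $\partial\Omega$, and such that $\|f_j\|_{L^2(\omega)}\to0$ as $j\to\infty$. Consequently, for every $C>0$ there is $u\in H^1_0(\Omega)$ with $\|\gamma_0(u)\|_{L^2(\partial\omega)}>C\|u\|_{L^2(\omega)}$. 2. (Lack of coercivity.) Let $\mathcal U,\Omega$ be bounded Lipschitz domains with $\overline{\mathcal U}\subset\Omega$, let $n\colon\overline\omega\to\mathbb R^d$ be continuous and equal, at every point of $\partial\mathcal U$, to the outward unit normal vector of $\mathcal U$ (which is assumed to exist at every point of $\partial\mathcal U$), and let $\alpha\ge0$. Then there is $\varepsilon_0>0$ such that $a_\varepsilon$ is not coercive on $H^1_0(\Omega)$ for any $\varepsilon\in(0,\varepsilon_0)$.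 3. (Coercivity fails in general.) There exist connected bounded Lipschitz domains $\mathcal U,\Omega\subset\mathbb R^d$ with $\overline{\mathcal U}\subset\Omega$ and a vector field $n\in H^1(\omega)^d\cap L^d(\omega)^d$, continuous on $\overline\omega$ and equal to the outward unit normal vector of $\mathcal U$ on $\partial\mathcal U$, such that for every $\alpha\ge0$ there is $\varepsilon_0>0$ for which $a_\varepsilon$ is not coercive on $H^1_0(\Omega)$ for any $\varepsilon\in(0,\varepsilon_0)$. -/

import Mathlib

open Set Filter Topology MeasureTheory
open scoped ENNReal NNReal ContDiff Gradient

noncomputable section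

namespace Penalization

/-- The Euclidean space `ℝ^d`. -/
abbrev E (d : ℕ) : Type := EuclideanSpace ℝ (Fin d)

/-! ### Domains -/

/-- Bounded Lipschitz domain: a nonempty bounded open set which, near each boundary point, is the
strict subgraph, in some direction `e`, of a Lipschitz function `γ` of the variables orthogonal
to `e` (that is, `γ` is invariant under translations along `e`). Connectedness is not required. -/
structure IsBoundedLipschitzDomain {d : ℕ} (D : Set (E d)) : Prop where
  isOpen : IsOpen D
  nonempty : D.Nonempty
  isBounded : Bornology.IsBounded D
  graph : ∀ p ∈ frontier D, ∃ (e : E d) (γ : E d → ℝ) (K : ℝ≥0) (r : ℝ),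
    ‖e‖ = 1 ∧ LipschitzWith K γ ∧ (∀ (x : E d) (t : ℝ), γ (x + t • e) = γ x) ∧ 0 < r ∧
    ∀ x ∈ Metric.ball p r, (x ∈ D ↔ inner ℝ x e < γ x)

/-- `ν` is the outward unit normal vector to `D` at the boundary point `p`: for every `c > 0`,
near `p`, the open cone `(x - p) · ν < - c |x - p|` lies in `D` and the opposite open cone
`(x - p) · ν > c |x - p|` lies outside of `D`. -/
def IsOutwardUnitNormal {d : ℕ} (D : Set (E d)) (p ν : E d) : Prop :=
  ‖ν‖ = 1 ∧ ∀ c : ℝ, 0 < c → ∃ r : ℝ, 0 < r ∧ ∀ x ∈ Metric.ball p r,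
    (inner ℝ (x - p) ν < -(c * ‖x - p‖) → x ∈ D) ∧
    (c * ‖x - p‖ < inner ℝ (x - p) ν → x ∉ D)

/-- The extended domain `ω = Ω \ closure U`. -/
def obstacle {d : ℕ} (Ω U : Set (E d)) : Set (E d) := Ω \ closure U

/-! ### Sobolev spaces -/

/-- Test functions: smooth functions on `ℝ^d` with compact support contained in `D`. -/
def IsTestFunction {d : ℕ} (D : Set (E d)) (φ : E d → ℝ) : Prop :=
  ContDiff ℝ ∞ φ ∧ HasCompactSupport φ ∧ tsupport φ ⊆ D

/-- `u ∈ L²(D)` has the weak gradient `G ∈ L²(D)^d` on the open set `D`. -/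
structure HasWeakGradient {d : ℕ} (D : Set (E d)) (u : E d → ℝ) (G : E d → E d) : Prop where
  memLp : MemLp u 2 (volume.restrict D)
  memLp_grad : MemLp G 2 (volume.restrict D)
  integral_eq : ∀ φ : E d → ℝ, IsTestFunction D φ →
    ∫ x in D, u x • ∇ φ x = -∫ x in D, φ x • G x

/-- The Sobolev space `H¹(D)`. -/
def MemH1 {d : ℕ} (D : Set (E d)) (u : E d → ℝ) : Prop := ∃ G, HasWeakGradient D u G

open Classical in
/-- The weak gradient on `D` of a function `u ∈ H¹(D)` (unique up to equality a.e. on `D`). -/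
def weakGrad {d : ℕ} (D : Set (E d)) (u : E d → ℝ) : E d → E d :=
  if h : MemH1 D u then h.choose else 0

/-- The smooth functions `φ k` converge to `u` in the norm of `H¹(D)`. -/
def TendstoH1 {d : ℕ} (D : Set (E d)) (φ : ℕ → E d → ℝ) (u : E d → ℝ) : Prop :=
  Tendsto (fun k => eLpNorm (fun x => φ k x - u x) 2 (volume.restrict D)) atTop (𝓝 0) ∧
  Tendsto (fun k => eLpNorm (fun x => ∇ (φ k) x - weakGrad D u x) 2 (volume.restrict D))
    atTop (𝓝 0)

/-- The space `H¹₀(D)`: the closure in `H¹(D)` of the test functions. -/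
def MemH10 {d : ℕ} (D : Set (E d)) (u : E d → ℝ) : Prop :=
  MemH1 D u ∧ ∃ φ : ℕ → E d → ℝ, (∀ k, IsTestFunction D (φ k)) ∧ TendstoH1 D φ u

/-- The square of the norm of `H¹(D)`. -/
def h1NormSq {d : ℕ} (D : Set (E d)) (u : E d → ℝ) : ℝ :=
  ∫ x in D, (‖weakGrad D u x‖ ^ 2 + u x ^ 2)

/-- The surface measure on the boundary of `D`: the `(d-1)`-dimensional Hausdorff measure,
normalized to agree with the Lebesgue measure on hyperplanes. -/
def surfaceMeasure {d : ℕ} (D : Set (E d)) : Measure (E d) :=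
  (μHE[d - 1] : Measure (E d)).restrict (frontier D)

/-- `g ∈ L²(∂D)` is the trace `γ₀(u)` on `∂D` of `u ∈ H¹(D)`: some sequence of functions that are
smooth up to the boundary converges to `u` in `H¹(D)`, and its restrictions to `∂D` converge
to `g` in `L²(∂D)`. -/
def HasTrace {d : ℕ} (D : Set (E d)) (u g : E d → ℝ) : Prop :=
  MemH1 D u ∧ MemLp g 2 (surfaceMeasure D) ∧
  ∃ φ : ℕ → E d → ℝ, (∀ k, ContDiff ℝ ∞ (φ k) ∧ HasCompactSupport (φ k)) ∧ TendstoH1 D φ u ∧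
    Tendsto (fun k => eLpNorm (fun x => φ k x - g x) 2 (surfaceMeasure D)) atTop (𝓝 0)

/-! ### The penalized problem -/

/-- The bilinear form of the penalized problem,
`a(u,v) = ∫_Ω (∇u·∇v + u v) + (1/ε) ∫_ω ((∇u·n) v + α u v)` with `ω = Ω \ closure U`. -/
def penalizedForm {d : ℕ} (Ω U : Set (E d)) (n : E d → E d) (α ε : ℝ) (u v : E d → ℝ) : ℝ :=
  (∫ x in Ω, (inner ℝ (weakGrad Ω u x) (weakGrad Ω v x) + u x * v x)) +
  1 / ε * ∫ x in obstacle Ω U, (inner ℝ (weakGrad Ω u x) (n x) * v x + α * u x * v x)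

/-- The bilinear form of the penalized problem is coercive on `H¹₀(Ω)`. -/
def IsCoerciveForm {d : ℕ} (Ω U : Set (E d)) (n : E d → E d) (α ε : ℝ) : Prop :=
  ∃ c : ℝ, 0 < c ∧ ∀ u : E d → ℝ, MemH10 Ω u →
    c * h1NormSq Ω u ≤ penalizedForm Ω U n α ε u u

/-! ### The explicit sequence -/

/-- The collar `ω_j = {x ∈ ω : d(x, ∂U) < 1/√j}`. -/
def collar {d : ℕ} (Ω U : Set (E d)) (j : ℕ) : Set (E d) :=
  {x ∈ obstacle Ω U | Metric.infDist x (frontier U) < 1 / Real.sqrt j}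

/-- `f` is the `j`-th function of the explicit sequence: it is `1` in `U` (the harmonic function
with boundary value `1`), it is `1 / (1 + j d(x, ∂U))` in the collar `ω_j`, and it is harmonic
in `ω \ closure ω_j`. The boundary values `0` on `∂Ω` and `1 / (1 + √j)` on the outer
boundary of `ω_j` of the harmonic part are expressed by the membership of `f` in `H¹₀(Ω)`. -/
structure IsExplicitFunction {d : ℕ} (Ω U : Set (E d)) (j : ℕ) (f : E d → ℝ) : Prop where
  memH10 : MemH10 Ω f
  eq_one : ∀ᵐ x ∂(volume.restrict U), f x = 1
  eq_collar : ∀ᵐ x ∂(volume.restrict (collar Ω U j)),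
    f x = 1 / (1 + (j : ℝ) * Metric.infDist x (frontier U))
  harmonic : ∀ φ : E d → ℝ, IsTestFunction (obstacle Ω U \ closure (collar Ω U j)) φ →
    ∫ x in obstacle Ω U, inner ℝ (weakGrad Ω f x) (∇ φ x) = 0

end Penalization

end

namespace Penalization

variable {d : ℕ}

/-! ### Gradients and test functions -/

/-! Write `ω` for `obstacle Ω U`. All functions used are built from `d(x, U)`, which on `ω` equals
`d(x, ∂U)`. They are Lipschitz with compact support in `Ω`, so mollification puts them in `H¹₀(Ω)`
with their a.e. (Rademacher) gradient as weak gradient (`exists_convergesH1_of_lipschitz`).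

Trace. The `competitor` is `1 / (1 + j d)` in the collar, is frozen at `1 / (1 + √j)` beyond it, and
is cut off to `0` at a fixed distance `δ`. It has all the required properties except harmonicity in
`W = ω \ closure (collar)`. There its gradient is `O(1/√j)`, since only the cutoff varies.
Projecting that gradient, restricted to `W`, onto the `L²` closure of gradients of test functions of
`W` gives a correction `w`, and `f = competitor - w` is weakly harmonic in `W`. Poincaré bounds `w`
in `L²` by `O(1/√j)`, while the competitor tends to `0` in `L²(ω)` by dominated convergence. The
correction is a limit of functions vanishing on `∂ω`, and mollification of the competitor converges
uniformly, so the trace is exactly the indicator of `∂U`. Its norm is positive and independent of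
`j`, whereas `‖f‖` in `L²(ω)` tends to `0`.

Coercivity. Take `u = max (0, 1 - k d(x, U))`. If `p` is a nearest point to `x ∈ ω`, a ball outside
`U` touches `U` at `p`, so the normal at `p` is `(x - p)/|x - p|`
(`IsOutwardUnitNormal.eq_of_disjoint_ball`), and the derivative of `u` in this direction is `-k`
(`inner_gradient_ramp`). Uniform continuity of `n` gives `∇u · n ≤ -k/2` on the support, so for `k ≥
2α + 2` the penalty integrand is at most `-u`. The form at this fixed `u` is thus `A + B/ε` with `B
< 0`, which is negative for small `ε`. Concentric balls with `n(x) = x` give the example. -/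

theorem gradient_eq_toDual_symm (f : E d → ℝ) (x : E d) :
    ∇ f x = (InnerProductSpace.toDual ℝ (E d)).symm (fderiv ℝ f x) := rfl

theorem norm_gradient_eq (f : E d → ℝ) (x : E d) : ‖∇ f x‖ = ‖fderiv ℝ f x‖ := by
  rw [gradient_eq_toDual_symm, LinearIsometryEquiv.norm_map]

theorem inner_gradient_eq (f : E d → ℝ) (x v : E d) : inner ℝ (∇ f x) v = fderiv ℝ f x v :=
  inner_gradient_left

theorem inner_gradient_eq' (f : E d → ℝ) (x v : E d) : inner ℝ v (∇ f x) = fderiv ℝ f x v := by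
  rw [real_inner_comm, inner_gradient_eq]

theorem gradient_sub_apply {f g : E d → ℝ} {x : E d} (hf : DifferentiableAt ℝ f x)
    (hg : DifferentiableAt ℝ g x) : ∇ (fun y => f y - g y) x = ∇ f x - ∇ g x := by
  simp only [gradient_eq_toDual_symm, fderiv_fun_sub hf hg, map_sub]

theorem gradient_add_apply {f g : E d → ℝ} {x : E d} (hf : DifferentiableAt ℝ f x)
    (hg : DifferentiableAt ℝ g x) : ∇ (fun y => f y + g y) x = ∇ f x + ∇ g x := by
  simp only [gradient_eq_toDual_symm, fderiv_fun_add hf hg, map_add]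

theorem gradient_const_mul_apply {f : E d → ℝ} {x : E d} (hf : DifferentiableAt ℝ f x) (c : ℝ) :
    ∇ (fun y => c * f y) x = c • ∇ f x := by
  simp only [gradient_eq_toDual_symm, fderiv_const_mul hf, map_smul]

theorem continuous_gradient {f : E d → ℝ} (hf : ContDiff ℝ ∞ f) : Continuous (∇ f) :=
  (InnerProductSpace.toDual ℝ (E d)).symm.continuous.comp (hf.continuous_fderiv (by simp))

theorem measurable_gradient (f : E d → ℝ) : Measurable (∇ f) :=
  (InnerProductSpace.toDual ℝ (E d)).symm.continuous.measurable.comp (measurable_fderiv ℝ f)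

theorem gradient_eq_zero_of_notMem_tsupport {f : E d → ℝ} {x : E d} (hx : x ∉ tsupport f) :
    ∇ f x = 0 := by
  rw [gradient_eq_toDual_symm, fderiv_of_notMem_tsupport ℝ hx, map_zero]

theorem hasCompactSupport_gradient {f : E d → ℝ} (hf : HasCompactSupport f) :
    HasCompactSupport (∇ f) :=
  HasCompactSupport.intro hf fun _ hx => gradient_eq_zero_of_notMem_tsupport hx

theorem IsTestFunction.differentiable {D : Set (E d)} {φ : E d → ℝ} (h : IsTestFunction D φ) :
    Differentiable ℝ φ := h.1.differentiable (by simp)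

theorem IsTestFunction.mono {D D' : Set (E d)} {φ : E d → ℝ} (h : IsTestFunction D φ)
    (hD : D ⊆ D') : IsTestFunction D' φ := ⟨h.1, h.2.1, h.2.2.trans hD⟩

theorem IsTestFunction.zero (D : Set (E d)) : IsTestFunction D (fun _ => 0) := by
  have h : tsupport (fun _ : E d => (0 : ℝ)) = ∅ := by simp
  exact ⟨contDiff_const, HasCompactSupport.zero, by simp [h]⟩

theorem IsTestFunction.add {D : Set (E d)} {φ ψ : E d → ℝ} (h : IsTestFunction D φ)
    (h' : IsTestFunction D ψ) : IsTestFunction D (fun x => φ x + ψ x) :=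
  ⟨h.1.add h'.1, h.2.1.add h'.2.1, (tsupport_add φ ψ).trans (union_subset h.2.2 h'.2.2)⟩

theorem IsTestFunction.const_mul {D : Set (E d)} {φ : E d → ℝ} (h : IsTestFunction D φ) (c : ℝ) :
    IsTestFunction D (fun x => c * φ x) :=
  ⟨contDiff_const.mul h.1, h.2.1.mul_left, (tsupport_mul_subset_right).trans h.2.2⟩

theorem IsTestFunction.sub {D : Set (E d)} {φ ψ : E d → ℝ} (h : IsTestFunction D φ)
    (h' : IsTestFunction D ψ) : IsTestFunction D (fun x => φ x - ψ x) := by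
  have := h.add (h'.const_mul (-1))
  simpa [sub_eq_add_neg] using this

theorem IsTestFunction.eq_zero {D : Set (E d)} {φ : E d → ℝ} (h : IsTestFunction D φ) {x : E d}
    (hx : x ∉ D) : φ x = 0 := image_eq_zero_of_notMem_tsupport fun h' => hx (h.2.2 h')

theorem IsTestFunction.gradient_eq_zero {D : Set (E d)} {φ : E d → ℝ} (h : IsTestFunction D φ)
    {x : E d} (hx : x ∉ D) : ∇ φ x = 0 :=
  gradient_eq_zero_of_notMem_tsupport fun h' => hx (h.2.2 h')

theorem memLp_of_contDiff {φ : E d → ℝ} (h : ContDiff ℝ ∞ φ) (h' : HasCompactSupport φ)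
    (μ : Measure (E d)) [IsFiniteMeasureOnCompacts μ] (p : ℝ≥0∞) : MemLp φ p μ :=
  h.continuous.memLp_of_hasCompactSupport h'

theorem memLp_gradient_of_contDiff {φ : E d → ℝ} (h : ContDiff ℝ ∞ φ) (h' : HasCompactSupport φ)
    (μ : Measure (E d)) [IsFiniteMeasureOnCompacts μ] (p : ℝ≥0∞) : MemLp (∇ φ) p μ :=
  (continuous_gradient h).memLp_of_hasCompactSupport (hasCompactSupport_gradient h')

theorem integral_smul_gradient_eq_neg {f φ : E d → ℝ} (hf : ContDiff ℝ ∞ f)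
    (hφ : ContDiff ℝ ∞ φ) (hc : HasCompactSupport φ) :
    ∫ x, f x • ∇ φ x = -∫ x, φ x • ∇ f x := by
  have i1 : Integrable (fun x => f x • ∇ φ x) :=
    (hf.continuous.smul (continuous_gradient hφ)).integrable_of_hasCompactSupport
      (hasCompactSupport_gradient hc).smul_left
  have i2 : Integrable (fun x => φ x • ∇ f x) :=
    (hφ.continuous.smul (continuous_gradient hf)).integrable_of_hasCompactSupport hc.smul_right
  refine ext_inner_right ℝ fun v => ?_
  rw [inner_neg_left, real_inner_comm, ← integral_inner (𝕜 := ℝ) i1 v, real_inner_comm,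
    ← integral_inner (𝕜 := ℝ) i2 v]
  have j1 := i1.const_inner (𝕜 := ℝ) v
  have j2 := i2.const_inner (𝕜 := ℝ) v
  simp only [inner_smul_right, inner_gradient_eq'] at j1 j2 ⊢
  simp only [mul_comm (φ _)] at j2 ⊢
  refine integral_mul_fderiv_eq_neg_fderiv_mul_of_integrable j2 j1 ?_
    (fun x _ => hf.differentiable (by simp) x) (fun x _ => hφ.differentiable (by simp) x)
  exact (hf.continuous.mul hφ.continuous).integrable_of_hasCompactSupport hc.mul_left

/-! ### Weak gradients -/

/-- The fundamental lemma of the calculus of variations. Since `weakGrad` is obtained by choice,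
this uniqueness is what allows it to be computed. -/
theorem HasWeakGradient.ae_eq {D : Set (E d)} (hD : IsOpen D) {u : E d → ℝ} {G G' : E d → E d}
    (h : HasWeakGradient D u G) (h' : HasWeakGradient D u G') :
    G =ᵐ[volume.restrict D] G' := by
  have hint : ∀ {H : E d → E d}, MemLp H 2 (volume.restrict D) → ∀ φ, IsTestFunction D φ →
      Integrable (fun x => φ x • H x) (volume.restrict D) := fun {H} hH φ hφ => by
    refine memLp_one_iff_integrable.1 ?_
    exact hH.smul (p := 2) (q := 2) (r := 1) (memLp_of_contDiff hφ.1 hφ.2.1 _ 2)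
  have key := hD.ae_eq_zero_of_integral_contDiff_smul_eq_zero (μ := volume)
    (f := fun x => G x - G' x) ?_ ?_
  · filter_upwards [(ae_restrict_iff' hD.measurableSet).2 key] with x hx
    exact sub_eq_zero.1 hx
  · have : LocallyIntegrable (fun x => G x - G' x) (volume.restrict D) :=
      (h.memLp_grad.sub h'.memLp_grad).locallyIntegrable (by norm_num)
    intro x hx
    obtain ⟨s, hs, hs'⟩ := this x
    refine ⟨s ∩ D, inter_mem (mem_nhdsWithin_of_mem_nhds hs) self_mem_nhdsWithin, ?_⟩
    rw [IntegrableOn, Measure.restrict_restrict_of_subset inter_subset_right |>.symm]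
    exact hs'.mono_set inter_subset_left
  · intro φ h1 h2 h3
    have hφ : IsTestFunction D φ := ⟨h1, h2, h3⟩
    have e1 := h.integral_eq φ hφ
    have e2 := h'.integral_eq φ hφ
    rw [← setIntegral_eq_integral_of_forall_compl_eq_zero (s := D)
      (fun x hx => by rw [hφ.eq_zero hx, zero_smul])]
    simp only [smul_sub]
    rw [integral_sub (hint h.memLp_grad φ hφ) (hint h'.memLp_grad φ hφ), sub_eq_zero]
    exact neg_injective (e1.symm.trans e2)

theorem MemH1.hasWeakGradient {D : Set (E d)} {u : E d → ℝ} (h : MemH1 D u) :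
    HasWeakGradient D u (weakGrad D u) := by
  rw [weakGrad, dif_pos h]
  exact h.choose_spec

theorem HasWeakGradient.weakGrad_ae_eq {D : Set (E d)} (hD : IsOpen D) {u : E d → ℝ}
    {G : E d → E d} (h : HasWeakGradient D u G) : weakGrad D u =ᵐ[volume.restrict D] G :=
  (MemH1.hasWeakGradient ⟨G, h⟩).ae_eq hD h

/-- By Hölder, both sides of the integration by parts formula are continuous under `L²` convergence,
and the formula is classical for each `φ k`. -/
theorem hasWeakGradient_of_tendsto {D : Set (E d)} {u : E d → ℝ} {G : E d → E d}
    (hu : MemLp u 2 (volume.restrict D)) (hG : MemLp G 2 (volume.restrict D))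
    {φ : ℕ → E d → ℝ} (hφ : ∀ k, ContDiff ℝ ∞ (φ k)) (hc : ∀ k, HasCompactSupport (φ k))
    (h1 : Tendsto (fun k => eLpNorm (fun x => φ k x - u x) 2 (volume.restrict D)) atTop (𝓝 0))
    (h2 : Tendsto (fun k => eLpNorm (fun x => ∇ (φ k) x - G x) 2 (volume.restrict D))
      atTop (𝓝 0)) : HasWeakGradient D u G := by
  refine ⟨hu, hG, fun ψ hψ => ?_⟩
  have mψ := memLp_of_contDiff hψ.1 hψ.2.1 (volume.restrict D) 2
  have mgψ := memLp_gradient_of_contDiff hψ.1 hψ.2.1 (volume.restrict D) 2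
  have mφ := fun k => memLp_of_contDiff (hφ k) (hc k) (volume.restrict D) 2
  have mgφ := fun k => memLp_gradient_of_contDiff (hφ k) (hc k) (volume.restrict D) 2
  have t1 : Tendsto (fun k => ∫ x in D, φ k x • ∇ ψ x) atTop (𝓝 (∫ x in D, u x • ∇ ψ x)) := by
    refine tendsto_integral_of_L1' _ (memLp_one_iff_integrable.1 (mgψ.smul (p := 2) (q := 2) hu)).1
      (Eventually.of_forall fun k => memLp_one_iff_integrable.1 (mgψ.smul (p := 2) (q := 2) (mφ k)))
      ?_
    have := ENNReal.Tendsto.mul_const h1 (Or.inr mgψ.eLpNorm_ne_top)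
    rw [zero_mul] at this
    refine tendsto_of_tendsto_of_tendsto_of_le_of_le tendsto_const_nhds
      this (fun _ => zero_le) fun k => ?_
    have := eLpNorm_smul_le_mul_eLpNorm (p := 2) (q := 2) (r := 1) mgψ.1 ((mφ k).sub hu).1
    refine le_trans (le_of_eq ?_) this
    congr 1; ext1 x; simp [sub_smul]
  have t2 : Tendsto (fun k => ∫ x in D, ψ x • ∇ (φ k) x) atTop (𝓝 (∫ x in D, ψ x • G x)) := by
    refine tendsto_integral_of_L1' _ (memLp_one_iff_integrable.1 (hG.smul (p := 2) (q := 2) mψ)).1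
      (Eventually.of_forall fun k => memLp_one_iff_integrable.1 ((mgφ k).smul (p := 2) (q := 2) mψ))
      ?_
    have := ENNReal.Tendsto.const_mul h2 (Or.inr mψ.eLpNorm_ne_top)
    rw [mul_zero] at this
    refine tendsto_of_tendsto_of_tendsto_of_le_of_le tendsto_const_nhds
      this (fun _ => zero_le) fun k => ?_
    have := eLpNorm_smul_le_mul_eLpNorm (p := 2) (q := 2) (r := 1) ((mgφ k).sub hG).1 mψ.1
    refine le_trans (le_of_eq ?_) this
    congr 1; ext1 x; simp [smul_sub]
  refine tendsto_nhds_unique t1 (t2.neg.congr fun k => ?_)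
  rw [setIntegral_eq_integral_of_forall_compl_eq_zero (f := fun x => φ k x • ∇ ψ x)
      (fun x hx => by rw [hψ.gradient_eq_zero hx, smul_zero]),
    setIntegral_eq_integral_of_forall_compl_eq_zero (f := fun x => ψ x • ∇ (φ k) x)
      (fun x hx => by rw [hψ.eq_zero hx, zero_smul]),
    integral_smul_gradient_eq_neg (hφ k) hψ.1 hψ.2.1]

/-! ### Limits of test functions -/

/-- The test functions `φ k` of `D` converge to `u`, and their gradients to `G`,
in `L²` of the whole space. -/
structure ConvergesH1 (D : Set (E d)) (φ : ℕ → E d → ℝ) (u : E d → ℝ) (G : E d → E d) : Prop where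
  test : ∀ k, IsTestFunction D (φ k)
  memLp : MemLp u 2 volume
  memLp_grad : MemLp G 2 volume
  tendsto : Tendsto (fun k => eLpNorm (fun x => φ k x - u x) 2 volume) atTop (𝓝 0)
  tendsto_grad : Tendsto (fun k => eLpNorm (fun x => ∇ (φ k) x - G x) 2 volume) atTop (𝓝 0)

theorem tendsto_eLpNorm_restrict {F : Type*} [NormedAddCommGroup F] {g : ℕ → E d → F}
    (h : Tendsto (fun k => eLpNorm (g k) 2 volume) atTop (𝓝 0)) (D : Set (E d)) :
    Tendsto (fun k => eLpNorm (g k) 2 (volume.restrict D)) atTop (𝓝 0) :=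
  tendsto_of_tendsto_of_tendsto_of_le_of_le tendsto_const_nhds h (fun _ => zero_le)
    fun _ => eLpNorm_mono_measure _ Measure.restrict_le_self

namespace ConvergesH1

variable {D : Set (E d)} {φ : ℕ → E d → ℝ} {u : E d → ℝ} {G : E d → E d}

theorem mono {D' : Set (E d)} (h : ConvergesH1 D φ u G) (hD : D ⊆ D') : ConvergesH1 D' φ u G :=
  ⟨fun k => (h.test k).mono hD, h.memLp, h.memLp_grad, h.tendsto, h.tendsto_grad⟩

theorem hasWeakGradient (h : ConvergesH1 D φ u G) (D' : Set (E d)) : HasWeakGradient D' u G :=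
  hasWeakGradient_of_tendsto (h.memLp.restrict _) (h.memLp_grad.restrict _)
    (fun k => (h.test k).1) (fun k => (h.test k).2.1) (tendsto_eLpNorm_restrict h.tendsto _)
    (tendsto_eLpNorm_restrict h.tendsto_grad _)

theorem memH1 (h : ConvergesH1 D φ u G) (D' : Set (E d)) : MemH1 D' u := ⟨G, h.hasWeakGradient D'⟩

theorem weakGrad_ae_eq (h : ConvergesH1 D φ u G) {D' : Set (E d)} (hD' : IsOpen D') :
    weakGrad D' u =ᵐ[volume.restrict D'] G := (h.hasWeakGradient D').weakGrad_ae_eq hD'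

theorem tendstoH1 (h : ConvergesH1 D φ u G) {D' : Set (E d)} (hD' : IsOpen D') :
    TendstoH1 D' φ u := by
  refine ⟨tendsto_eLpNorm_restrict h.tendsto _, ?_⟩
  refine (tendsto_eLpNorm_restrict h.tendsto_grad D').congr fun k => eLpNorm_congr_ae ?_
  filter_upwards [h.weakGrad_ae_eq hD'] with x hx
  rw [hx]

theorem memH10 (h : ConvergesH1 D φ u G) (hD : IsOpen D) : MemH10 D u :=
  ⟨h.memH1 D, φ, h.test, h.tendstoH1 hD⟩

theorem sub {ψ : ℕ → E d → ℝ} {v : E d → ℝ} {H : E d → E d} (h : ConvergesH1 D φ u G)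
    (h' : ConvergesH1 D ψ v H) :
    ConvergesH1 D (fun k x => φ k x - ψ k x) (fun x => u x - v x) (fun x => G x - H x) := by
  refine ⟨fun k => (h.test k).sub (h'.test k), h.memLp.sub h'.memLp,
    h.memLp_grad.sub h'.memLp_grad, ?_, ?_⟩
  · have := h.tendsto.add h'.tendsto
    rw [add_zero] at this
    refine tendsto_of_tendsto_of_tendsto_of_le_of_le tendsto_const_nhds this
      (fun _ => zero_le) fun k => ?_
    refine le_trans (le_of_eq ?_) (eLpNorm_sub_le
      ((memLp_of_contDiff (h.test k).1 (h.test k).2.1 _ 2).sub h.memLp).1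
      ((memLp_of_contDiff (h'.test k).1 (h'.test k).2.1 _ 2).sub h'.memLp).1 (by norm_num))
    congr 1; ext1 x; simp; ring
  · have := h.tendsto_grad.add h'.tendsto_grad
    rw [add_zero] at this
    refine tendsto_of_tendsto_of_tendsto_of_le_of_le tendsto_const_nhds this
      (fun _ => zero_le) fun k => ?_
    refine le_trans (le_of_eq ?_) (eLpNorm_sub_le
      ((memLp_gradient_of_contDiff (h.test k).1 (h.test k).2.1 _ 2).sub h.memLp_grad).1
      ((memLp_gradient_of_contDiff (h'.test k).1 (h'.test k).2.1 _ 2).sub h'.memLp_grad).1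
      (by norm_num))
    congr 1; ext1 x
    simp only [Pi.sub_apply]
    rw [gradient_sub_apply ((h.test k).differentiable x) ((h'.test k).differentiable x)]
    abel

/-- Every `φ k` vanishes on `A`, so the distance from `φ k` to `u` in `L²(A)` is the constant `‖u‖`,
and this constant sequence tends to `0`. -/
theorem ae_eq_zero_compl (h : ConvergesH1 D φ u G) {A : Set (E d)}
    (hA : MeasurableSet A) (hDA : Disjoint D A) : ∀ᵐ x ∂(volume.restrict A), u x = 0 := by
  have := tendsto_eLpNorm_restrict h.tendsto A
  have e : ∀ k, eLpNorm (fun x => φ k x - u x) 2 (volume.restrict A) =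
      eLpNorm u 2 (volume.restrict A) := fun k => by
    rw [← eLpNorm_neg u]
    refine eLpNorm_congr_ae ?_
    filter_upwards [ae_restrict_mem hA] with x hx
    simp [(h.test k).eq_zero (disjoint_right.1 hDA hx)]
  simp only [e] at this
  have h0 := tendsto_nhds_unique tendsto_const_nhds this
  exact (eLpNorm_eq_zero_iff (h.memLp.restrict A).1 (by norm_num)).1 h0

end ConvergesH1

/-! ### Approximation of Lipschitz functions -/

theorem tendsto_eLpNorm_two_of_dominated {α F : Type*} [MeasurableSpace α] {μ : Measure α}
    [NormedAddCommGroup F] {g : ℕ → α → F} {C : ℝ} {S : Set α} (hS : MeasurableSet S)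
    (hS' : μ S ≠ ⊤) (hm : ∀ k, AEStronglyMeasurable (g k) μ) (hC : ∀ k x, ‖g k x‖ ≤ C)
    (h0 : ∀ k, ∀ x ∉ S, g k x = 0) (hlim : ∀ᵐ x ∂μ, Tendsto (fun k => g k x) atTop (𝓝 0)) :
    Tendsto (fun k => eLpNorm (g k) 2 μ) atTop (𝓝 0) := by
  have key : Tendsto (fun k => ∫⁻ x, ‖g k x‖ₑ ^ (2 : ℝ) ∂μ) atTop (𝓝 (∫⁻ _, 0 ∂μ)) := by
    refine tendsto_lintegral_of_dominated_convergence'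
      (S.indicator fun _ => ENNReal.ofReal C ^ (2 : ℝ)) (fun k => (hm k).enorm.pow_const _)
      (fun k => Eventually.of_forall fun x => ?_) ?_ ?_
    · by_cases hx : x ∈ S
      · rw [indicator_of_mem hx]
        refine ENNReal.rpow_le_rpow ?_ (by norm_num)
        rw [← ofReal_norm]
        exact ENNReal.ofReal_le_ofReal (hC k x)
      · simp [h0 k x hx]
    · rw [lintegral_indicator hS, setLIntegral_const]
      exact ENNReal.mul_ne_top (by finiteness) hS'
    · filter_upwards [hlim] with x hx
      have := ((ENNReal.continuous_rpow_const (y := 2)).tendsto _).comp hx.enorm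
      simpa [Function.comp_def] using this
  rw [lintegral_zero] at key
  have := ((ENNReal.continuous_rpow_const (y := 1 / 2)).tendsto _).comp key
  have e : (0 : ℝ≥0∞) ^ (1 / 2 : ℝ) = 0 := by simp
  rw [e] at this
  refine this.congr fun k => ?_
  rw [eLpNorm_eq_lintegral_rpow_enorm_toReal (by norm_num) (by norm_num)]
  simp

theorem LipschitzWith.norm_gradient_le {h : E d → ℝ} {K : ℝ≥0} (hh : LipschitzWith K h)
    (x : E d) : ‖∇ h x‖ ≤ K := by
  rw [norm_gradient_eq]
  exact norm_fderiv_le_of_lipschitz ℝ hh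

theorem memLp_of_bounded_of_support {F : Type*} [NormedAddCommGroup F] {g : E d → F} {S : Set (E d)}
    (hS : volume S ≠ ⊤) {C : ℝ} (hm : AEStronglyMeasurable g volume)
    (hC : ∀ x, ‖g x‖ ≤ C) (h0 : ∀ x ∉ S, g x = 0) (p : ℝ≥0∞) : MemLp g p volume := by
  have : IsFiniteMeasure (volume.restrict S) := ⟨by simpa [lt_top_iff_ne_top] using hS⟩
  have h := MemLp.of_bound (p := p) (hm.restrict (s := S)) C (Eventually.of_forall hC)
  have hS' : Function.support g ⊆ S := fun x hx => by
    by_contra h'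
    exact hx (h0 x h')
  refine ⟨hm, ?_⟩
  rw [← eLpNorm_restrict_eq_of_support_subset hS']
  exact h.2

open ContinuousLinearMap in
-- Differentiation under the integral. By Rademacher, `h` is differentiable at `x - t` for a.e. `t`,
-- and the Lipschitz bound dominates the difference quotients.
theorem gradient_convolution {h : E d → ℝ} {K : ℝ≥0} (hh : LipschitzWith K h)
    (ρ : ContDiffBump (0 : E d)) (x : E d) :
    ∇ (convolution (ρ.normed volume) h (lsmul ℝ ℝ) volume) x =
      convolution (ρ.normed volume) (∇ h) (lsmul ℝ ℝ) volume x := by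
  have hρc := ρ.continuous_normed (μ := volume)
  have hρi : Integrable (ρ.normed volume) := ρ.integrable_normed
  have key := hasFDerivAt_integral_of_dominated_loc_of_lip' (μ := volume) (𝕜 := ℝ)
    (F := fun y t => ρ.normed volume t * h (y - t))
    (F' := fun t => ρ.normed volume t • fderiv ℝ h (x - t))
    (bound := fun t => ρ.normed volume t * K) (x₀ := x) (s := univ) univ_mem
    (fun y _ => (hρc.mul (hh.continuous.comp (by fun_prop))).aestronglyMeasurable) ?_ ?_ ?_
    (hρi.mul_const _) ?_
  · have e : ∀ y, convolution (ρ.normed volume) h (lsmul ℝ ℝ) volume y =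
        ∫ t, ρ.normed volume t * h (y - t) := fun y => by simp [convolution_def]
    rw [gradient_eq_toDual_symm, funext e, key.2.fderiv, convolution_def]
    have := (InnerProductSpace.toDual ℝ (E d)).symm.toContinuousLinearEquiv.toContinuousLinearMap.integral_comp_comm key.1
    refine Eq.trans this.symm ?_
    simp [gradient_eq_toDual_symm]
  · exact (hρc.mul (hh.continuous.comp (by fun_prop))).integrable_of_hasCompactSupport
      ρ.hasCompactSupport_normed.mul_right
  · exact hρc.aestronglyMeasurable.smul
      ((measurable_fderiv ℝ h).comp (by fun_prop)).aestronglyMeasurable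
  · refine Eventually.of_forall fun t y _ => ?_
    rw [← mul_sub, norm_mul, mul_assoc, Real.norm_of_nonneg (ρ.nonneg_normed t)]
    refine mul_le_mul_of_nonneg_left ?_ (ρ.nonneg_normed t)
    have := hh.norm_sub_le (y - t) (x - t)
    simpa using this
  · have h1 : ∀ᵐ t : E d, DifferentiableAt ℝ h t := hh.ae_differentiableAt
    have h2 := (quasiMeasurePreserving_sub_left volume x).ae h1
    filter_upwards [h2] with t ht
    have h3 : HasFDerivAt (fun y => h (y - t)) (fderiv ℝ h (x - t)) x :=
      (hasFDerivAt_comp_sub t).2 ht.hasFDerivAt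
    exact h3.const_mul _

/-- Mollification at scale `δ / (k + 1)`, with `δ` keeping the supports inside `D`. The gradients
stay bounded by `K` and converge a.e., so dominated convergence applies. The uniform error bound is
recorded because `L²` convergence in the interior says nothing about boundary values. -/
theorem exists_convergesH1_of_lipschitz {D : Set (E d)} (hD : IsOpen D) {h : E d → ℝ} {K : ℝ≥0}
    (hh : LipschitzWith K h) (hc : HasCompactSupport h) (hs : tsupport h ⊆ D) :
    ∃ φ : ℕ → E d → ℝ, ConvergesH1 D φ h (∇ h) ∧
      ∃ b : ℕ → ℝ, Tendsto b atTop (𝓝 0) ∧ ∀ k x, |φ k x - h x| ≤ b k := by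
  obtain ⟨δ, δpos, hδ⟩ := hc.isCompact.exists_cthickening_subset_open hD hs
  have rpos : ∀ k : ℕ, 0 < δ / (k + 1) := fun k => by positivity
  have rle : ∀ k : ℕ, δ / (k + 1) ≤ δ := fun k => div_le_self δpos.le (by simp)
  let ρ : ℕ → ContDiffBump (0 : E d) := fun k =>
    ⟨δ / (k + 1) / 2, δ / (k + 1), half_pos (rpos k), half_lt_self (rpos k)⟩
  have hr : Tendsto (fun k : ℕ => δ / ((k : ℝ) + 1)) atTop (𝓝 0) :=
    tendsto_const_nhds.div_atTop (tendsto_natCast_atTop_atTop.atTop_add tendsto_const_nhds)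
  let φ : ℕ → E d → ℝ := fun k =>
    convolution ((ρ k).normed volume) h (ContinuousLinearMap.lsmul ℝ ℝ) volume
  have hhi : Integrable h := hh.continuous.integrable_of_hasCompactSupport hc
  have hφ : ∀ k, ContDiff ℝ ∞ (φ k) := fun k =>
    HasCompactSupport.contDiff_convolution_left _ (ρ k).hasCompactSupport_normed
      (ρ k).contDiff_normed hhi.locallyIntegrable
  let S := Metric.cthickening δ (tsupport h)
  have hS : IsCompact S := hc.isCompact.cthickening
  have hsupp : ∀ k, tsupport (φ k) ⊆ S := fun k => by
    refine closure_minimal ?_ Metric.isClosed_cthickening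
    refine (support_convolution_subset _).trans ?_
    rintro _ ⟨a, ha, b, hb, rfl⟩
    rw [ContDiffBump.support_normed_eq, mem_ball_zero_iff] at ha
    refine Metric.mem_cthickening_of_dist_le _ b _ _ (subset_tsupport h hb) ?_
    simpa [dist_eq_norm] using ha.le.trans (rle k)
  have htest : ∀ k, IsTestFunction D (φ k) := fun k =>
    ⟨hφ k, hS.of_isClosed_subset (isClosed_tsupport _) (hsupp k), (hsupp k).trans hδ⟩
  have hb : ∀ k x, |φ k x - h x| ≤ K * (δ / (k + 1)) := fun k x => by
    rw [← Real.dist_eq]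
    refine (ρ k).dist_normed_convolution_le hh.continuous.aestronglyMeasurable fun y hy => ?_
    exact (hh.dist_le_mul y x).trans (mul_le_mul_of_nonneg_left (Metric.mem_ball.1 hy).le K.2)
  have hbt : Tendsto (fun k : ℕ => (K : ℝ) * (δ / (k + 1))) atTop (𝓝 0) := by
    simpa using hr.const_mul (K : ℝ)
  have hsub : tsupport h ⊆ S := Metric.self_subset_cthickening _
  have hh0 : ∀ x ∉ S, h x = 0 := fun x hx =>
    image_eq_zero_of_notMem_tsupport fun h' => hx (hsub h')
  have hg0 : ∀ x ∉ S, ∇ h x = 0 := fun x hx =>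
    gradient_eq_zero_of_notMem_tsupport fun h' => hx (hsub h')
  have hgrad : ∀ k x, ∇ (φ k) x = convolution ((ρ k).normed volume) (∇ h)
      (ContinuousLinearMap.lsmul ℝ ℝ) volume x := fun k x => gradient_convolution hh (ρ k) x
  have hgb : ∀ k x, ‖∇ (φ k) x‖ ≤ K := fun k x => by
    rw [hgrad, convolution_def]
    refine (norm_integral_le_of_norm_le ((ρ k).integrable_normed.mul_const (K : ℝ))
      (Eventually.of_forall fun t => ?_)).trans (le_of_eq ?_)
    · rw [ContinuousLinearMap.lsmul_apply, norm_smul, Real.norm_of_nonneg ((ρ k).nonneg_normed t)]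
      exact mul_le_mul_of_nonneg_left (LipschitzWith.norm_gradient_le hh _) ((ρ k).nonneg_normed t)
    · rw [integral_mul_const, (ρ k).integral_normed, one_mul]
  have hgm : MemLp (∇ h) 2 volume := memLp_of_bounded_of_support hS.measure_lt_top.ne
    (measurable_gradient h).aestronglyMeasurable (LipschitzWith.norm_gradient_le hh) hg0 2
  refine ⟨φ, ⟨htest, hh.continuous.memLp_of_hasCompactSupport hc, hgm, ?_, ?_⟩, _, hbt, hb⟩
  · refine tendsto_eLpNorm_two_of_dominated (C := K * δ) hS.measurableSet hS.measure_lt_top.ne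
      (fun k => ((hφ k).continuous.sub hh.continuous).aestronglyMeasurable)
      (fun k x => (hb k x).trans (mul_le_mul_of_nonneg_left (rle k) K.2))
      (fun k x hx => ?_) (Eventually.of_forall fun x => ?_)
    · rw [hh0 x hx, image_eq_zero_of_notMem_tsupport fun h' => hx (hsupp k h'), sub_zero]
    · exact squeeze_zero_norm (fun k => hb k x) hbt
  · refine tendsto_eLpNorm_two_of_dominated (C := K + K) hS.measurableSet hS.measure_lt_top.ne
      (fun k => ((measurable_gradient _).sub (measurable_gradient _)).aestronglyMeasurable)
      (fun k x => (norm_sub_le _ _).trans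
        (add_le_add (hgb k x) (LipschitzWith.norm_gradient_le hh x)))
      (fun k x hx => ?_) ?_
    · rw [hg0 x hx, gradient_eq_zero_of_notMem_tsupport fun h' => hx (hsupp k h'), sub_zero]
    -- The constant `2` is the ratio of the outer to the inner radius of the bumps; keeping it
    -- bounded gives convergence a.e.
    · have := ContDiffBump.ae_convolution_tendsto_right_of_locallyIntegrable (μ := volume)
        (φ := ρ) (K := 2) (g := ∇ h) hr (Eventually.of_forall fun k => ?_)
        (hgm.locallyIntegrable (by norm_num))
      · filter_upwards [this] with x hx
        simp only [hgrad]
        simpa using hx.sub_const (∇ h x)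
      · show δ / ((k : ℝ) + 1) ≤ 2 * (δ / (k + 1) / 2)
        linarith

/-! ### The Poincaré inequality -/

theorem eLpNorm_two_eq_ofReal_sqrt {α F : Type*} [MeasurableSpace α] {μ : Measure α}
    [NormedAddCommGroup F] {f : α → F} (hf : MemLp f 2 μ) :
    eLpNorm f 2 μ = ENNReal.ofReal (Real.sqrt (∫ x, ‖f x‖ ^ 2 ∂μ)) := by
  rw [hf.eLpNorm_eq_integral_rpow_norm (by norm_num) (by norm_num), Real.sqrt_eq_rpow]
  simp

/-- Write `φ² = φ² ∂ᵢxᵢ`, integrate by parts, and absorb half of `φ²` using `|xᵢ| ≤ R` on `D`. -/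
theorem integral_sq_le_integral_norm_gradient_sq (hd : 0 < d) {D : Set (E d)} {R : ℝ}
    (hD : D ⊆ Metric.closedBall 0 R) {φ : E d → ℝ} (hφ : IsTestFunction D φ) :
    ∫ x, φ x ^ 2 ≤ 4 * R ^ 2 * ∫ x, ‖∇ φ x‖ ^ 2 := by
  let i : Fin d := ⟨0, hd⟩
  let e : E d := EuclideanSpace.single i 1
  have he : ‖e‖ = 1 := by simp [e]
  have hdiff := hφ.differentiable
  have hcd : Continuous fun x => fderiv ℝ φ x e :=
    (hφ.1.continuous_fderiv (by simp)).clm_apply continuous_const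
  have hφ2 : ∀ x, fderiv ℝ (fun y => φ y ^ 2) x e = 2 * φ x * fderiv ℝ φ x e := fun x => by
    rw [fderiv_fun_pow 2 (hdiff x)]
    simp
  have hpr : ∀ x : E d, HasFDerivAt (fun y : E d => y i) (EuclideanSpace.proj i : E d →L[ℝ] ℝ) x :=
    fun x => (EuclideanSpace.proj i : E d →L[ℝ] ℝ).hasFDerivAt
  have hfd : ∀ x : E d, fderiv ℝ (fun y : E d => y i) x e = 1 := fun x => by
    rw [(hpr x).fderiv]
    simp [e]
  have hcx : Continuous fun x : E d => x i := (EuclideanSpace.proj i : E d →L[ℝ] ℝ).continuous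
  have hsq : HasCompactSupport fun x => φ x ^ 2 := by
    simp only [pow_two]
    exact hφ.2.1.mul_left
  have i0 : Integrable fun x => φ x ^ 2 :=
    (hφ.1.continuous.pow 2).integrable_of_hasCompactSupport hsq
  have i1 : Integrable fun x => x i * (2 * φ x * fderiv ℝ φ x e) :=
    (hcx.mul ((continuous_const.mul hφ.1.continuous).mul hcd)).integrable_of_hasCompactSupport
      ((hφ.2.1.mul_left.mul_right).mul_left)
  have i2 : Integrable fun x => ‖∇ φ x‖ ^ 2 :=
    ((continuous_gradient hφ.1).norm.pow 2).integrable_of_hasCompactSupport (by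
      simpa only [pow_two] using (hasCompactSupport_gradient hφ.2.1).norm.mul_left)
  have ibp := integral_mul_fderiv_eq_neg_fderiv_mul_of_integrable (μ := volume) (𝕜 := ℝ)
    (f := fun x : E d => x i) (g := fun x => φ x ^ 2) (v := e)
    (by simpa only [hfd, one_mul] using i0) (by simpa only [hφ2] using i1)
    ((hcx.mul (hφ.1.continuous.pow 2)).integrable_of_hasCompactSupport hsq.mul_left)
    (fun x _ => (hpr x).differentiableAt) (fun x _ => (hdiff x).pow 2)
  simp only [hfd, hφ2, one_mul] at ibp
  have hle : ∀ x, -(x i * (2 * φ x * fderiv ℝ φ x e)) ≤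
      φ x ^ 2 / 2 + 2 * R ^ 2 * ‖∇ φ x‖ ^ 2 := fun x => by
    by_cases hx : x ∈ D
    · have hR : ‖x‖ ≤ R := by simpa using hD hx
      have h1 : |x i| ≤ R := (PiLp.norm_apply_le x i).trans hR
      have h2 : |fderiv ℝ φ x e| ≤ ‖∇ φ x‖ := by
        rw [norm_gradient_eq]
        simpa [he] using (fderiv ℝ φ x).le_opNorm e
      have h3 : |x i * fderiv ℝ φ x e| ≤ R * ‖∇ φ x‖ := by
        rw [abs_mul]
        exact mul_le_mul h1 h2 (abs_nonneg _) ((abs_nonneg _).trans h1)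
      have h4 : (x i * fderiv ℝ φ x e) ^ 2 ≤ (R * ‖∇ φ x‖) ^ 2 := by
        rw [← sq_abs]
        exact pow_le_pow_left₀ (abs_nonneg _) h3 2
      -- With `a = xᵢ ∂ᵢφ`, expanding `(φ + 2a)² ≥ 0` gives `-2φa ≤ φ²/2 + 2a²`.
      nlinarith [sq_nonneg (φ x + 2 * (x i * fderiv ℝ φ x e))]
    · rw [hφ.eq_zero hx]
      have := sq_nonneg (R * ‖∇ φ x‖)
      nlinarith
  have := integral_mono i1.neg ((i0.div_const 2).add (i2.const_mul (2 * R ^ 2))) hle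
  simp only [Pi.neg_apply, Pi.add_apply] at this
  rw [integral_neg, ibp, integral_add (i0.div_const 2) (i2.const_mul (2 * R ^ 2)),
    integral_div, integral_const_mul] at this
  linarith

theorem IsTestFunction.eLpNorm_le (hd : 0 < d) {D : Set (E d)} {R : ℝ} (hR : 0 ≤ R)
    (hD : D ⊆ Metric.closedBall 0 R) {φ : E d → ℝ} (hφ : IsTestFunction D φ) :
    eLpNorm φ 2 volume ≤ ENNReal.ofReal (2 * R) * eLpNorm (∇ φ) 2 volume := by
  rw [eLpNorm_two_eq_ofReal_sqrt (memLp_of_contDiff hφ.1 hφ.2.1 _ 2),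
    eLpNorm_two_eq_ofReal_sqrt (memLp_gradient_of_contDiff hφ.1 hφ.2.1 _ 2),
    ← ENNReal.ofReal_mul (by positivity)]
  refine ENNReal.ofReal_le_ofReal (Real.sqrt_le_iff.2 ⟨by positivity, ?_⟩)
  rw [mul_pow, Real.sq_sqrt (integral_nonneg fun _ => by positivity)]
  have := integral_sq_le_integral_norm_gradient_sq hd hD hφ
  simp only [Real.norm_eq_abs, sq_abs]
  linarith

theorem ConvergesH1.eLpNorm_le (hd : 0 < d) {D : Set (E d)} {R : ℝ} (hR : 0 ≤ R)
    (hD : D ⊆ Metric.closedBall 0 R) {φ : ℕ → E d → ℝ} {u : E d → ℝ} {G : E d → E d}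
    (h : ConvergesH1 D φ u G) :
    eLpNorm u 2 volume ≤ ENNReal.ofReal (2 * R) * eLpNorm G 2 volume := by
  have hlim : Tendsto (fun k => eLpNorm (fun x => φ k x - u x) 2 volume + ENNReal.ofReal (2 * R) *
      (eLpNorm (fun x => ∇ (φ k) x - G x) 2 volume + eLpNorm G 2 volume)) atTop
      (𝓝 (0 + ENNReal.ofReal (2 * R) * (0 + eLpNorm G 2 volume))) :=
    h.tendsto.add (ENNReal.Tendsto.const_mul (h.tendsto_grad.add tendsto_const_nhds)
      (Or.inr ENNReal.ofReal_ne_top))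
  rw [zero_add, zero_add] at hlim
  refine ge_of_tendsto' hlim fun k => ?_
  have m1 := memLp_of_contDiff (h.test k).1 (h.test k).2.1 volume 2
  have m2 := memLp_gradient_of_contDiff (h.test k).1 (h.test k).2.1 volume 2
  have e1 : u = fun x => φ k x - (φ k x - u x) := by ext x; ring
  have e2 : ∇ (φ k) = fun x => (∇ (φ k) x - G x) + G x := by ext1 x; abel
  calc eLpNorm u 2 volume = eLpNorm (φ k - fun x => φ k x - u x) 2 volume := by
        conv_lhs => rw [e1]
        rfl
    _ ≤ eLpNorm (φ k) 2 volume + eLpNorm (fun x => φ k x - u x) 2 volume :=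
        eLpNorm_sub_le m1.1 (m1.sub h.memLp).1 (by norm_num)
    _ ≤ ENNReal.ofReal (2 * R) * eLpNorm (∇ (φ k)) 2 volume +
        eLpNorm (fun x => φ k x - u x) 2 volume := by
        gcongr
        exact (h.test k).eLpNorm_le hd hR hD
    _ ≤ ENNReal.ofReal (2 * R) *
        (eLpNorm (fun x => ∇ (φ k) x - G x) 2 volume + eLpNorm G 2 volume) +
        eLpNorm (fun x => φ k x - u x) 2 volume := by
        gcongr
        conv_lhs => rw [e2]
        exact eLpNorm_add_le (m2.sub h.memLp_grad).1 h.memLp_grad.1 (by norm_num)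
    _ = _ := add_comm _ _

/-! ### The Dirichlet problem -/

/-- The gradients of the test functions of `D`, as a subspace of `L²`. -/
def gradientSpace (D : Set (E d)) : Submodule ℝ (Lp (E d) 2 (volume : Measure (E d))) where
  carrier := {g | ∃ φ, IsTestFunction D φ ∧ g =ᵐ[volume] ∇ φ}
  zero_mem' := by
    refine ⟨_, IsTestFunction.zero D, ?_⟩
    exact Eventually.of_forall fun x => by simp
  add_mem' := by
    rintro a b ⟨φ, hφ, ha⟩ ⟨ψ, hψ, hb⟩
    refine ⟨_, hφ.add hψ, ?_⟩
    filter_upwards [ha, hb, Lp.coeFn_add a b] with x h1 h2 h3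
    rw [h3, Pi.add_apply, h1, h2, gradient_add_apply (hφ.differentiable x) (hψ.differentiable x)]
  smul_mem' := by
    rintro c a ⟨φ, hφ, ha⟩
    refine ⟨_, hφ.const_mul c, ?_⟩
    filter_upwards [ha, Lp.coeFn_smul c a] with x h1 h3
    rw [h3, Pi.smul_apply, h1, gradient_const_mul_apply (hφ.differentiable x)]

/-- By Poincaré, convergence of the gradients makes the test functions themselves Cauchy in `L²`;
hence every limit of gradients has a potential. -/
theorem exists_convergesH1_of_mem_closure (hd : 0 < d) {D : Set (E d)} {R : ℝ} (hR : 0 ≤ R)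
    (hD : D ⊆ Metric.closedBall 0 R) {v : Lp (E d) 2 (volume : Measure (E d))}
    (hv : v ∈ (gradientSpace D).topologicalClosure) :
    ∃ (φ : ℕ → E d → ℝ) (w : E d → ℝ), ConvergesH1 D φ w v := by
  obtain ⟨g, hg, hgv⟩ := mem_closure_iff_seq_limit.1 hv
  choose φ hφ hφg using hg
  have mφ := fun k => memLp_of_contDiff (hφ k).1 (hφ k).2.1 volume 2
  have hle : ∀ k l, dist ((mφ k).toLp (φ k)) ((mφ l).toLp (φ l)) ≤ 2 * R * dist (g k) (g l) := by
    intro k l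
    rw [dist_eq_norm_sub, dist_eq_norm_sub, ← MemLp.toLp_sub, Lp.norm_toLp, Lp.norm_def,
      ← ENNReal.toReal_ofReal (show 0 ≤ 2 * R by positivity), ← ENNReal.toReal_mul]
    refine ENNReal.toReal_mono (ENNReal.mul_ne_top ENNReal.ofReal_ne_top (Lp.eLpNorm_ne_top _)) ?_
    refine (((hφ k).sub (hφ l)).eLpNorm_le hd hR hD).trans (le_of_eq ?_)
    congr 1
    refine eLpNorm_congr_ae ?_
    filter_upwards [hφg k, hφg l, Lp.coeFn_sub (g k) (g l)] with x h1 h2 h3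
    rw [h3, Pi.sub_apply, h1, h2,
      gradient_sub_apply ((hφ k).differentiable x) ((hφ l).differentiable x)]
  have hcau : CauchySeq fun k => (mφ k).toLp (φ k) := by
    rw [Metric.cauchySeq_iff]
    intro ε hε
    -- The `+ 1` covers `R = 0`.
    obtain ⟨N, hN⟩ := Metric.cauchySeq_iff.1 hgv.cauchySeq (ε / (2 * R + 1)) (by positivity)
    refine ⟨N, fun k hk l hl => (hle k l).trans_lt ?_⟩
    have h1 := hN k hk l hl
    rw [lt_div_iff₀ (by positivity)] at h1
    nlinarith [dist_nonneg (x := g k) (y := g l)]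
  obtain ⟨w, hw⟩ := cauchySeq_tendsto_of_complete hcau
  refine ⟨φ, w, hφ, Lp.memLp w, Lp.memLp v, ?_, ?_⟩
  · have := (Lp.tendsto_Lp_iff_tendsto_eLpNorm' _ _).1 hw
    refine this.congr fun k => eLpNorm_congr_ae ?_
    filter_upwards [(mφ k).coeFn_toLp] with x hx
    simp [hx]
  · have := (Lp.tendsto_Lp_iff_tendsto_eLpNorm' _ _).1 hgv
    refine this.congr fun k => eLpNorm_congr_ae ?_
    filter_upwards [hφg k] with x hx
    simp [hx]

/-- The Dirichlet problem solved by orthogonal projection of `F` onto the closed span of test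
gradients: the residual `F - v` is weakly divergence free in `D`, and the projection does not
increase the norm. -/
theorem exists_dirichlet_projection (hd : 0 < d) {D : Set (E d)} {R : ℝ} (hR : 0 ≤ R)
    (hD : D ⊆ Metric.closedBall 0 R) {F : E d → E d} (hF : MemLp F 2 volume) :
    ∃ (φ : ℕ → E d → ℝ) (w : E d → ℝ) (v : E d → E d), ConvergesH1 D φ w v ∧
      eLpNorm v 2 volume ≤ eLpNorm F 2 volume ∧
      ∀ ψ, IsTestFunction D ψ → ∫ x, inner ℝ (F x - v x) (∇ ψ x) = 0 := by
  let K := (gradientSpace D).topologicalClosure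
  have : CompleteSpace K := (gradientSpace D).isClosed_topologicalClosure.completeSpace_coe
  let v := K.starProjection (hF.toLp F)
  obtain ⟨φ, w, h⟩ := exists_convergesH1_of_mem_closure hd hR hD
    (K.starProjection_apply_mem (hF.toLp F))
  refine ⟨φ, w, v, h, ?_, fun ψ hψ => ?_⟩
  · have := K.norm_starProjection_apply_le (hF.toLp F)
    rw [Lp.norm_toLp, Lp.norm_def] at this
    exact (ENNReal.toReal_le_toReal (Lp.eLpNorm_ne_top _) hF.eLpNorm_ne_top).1 this
  · have mψ := memLp_gradient_of_contDiff hψ.1 hψ.2.1 volume 2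
    have hmem : mψ.toLp (∇ ψ) ∈ K :=
      (gradientSpace D).le_topologicalClosure ⟨ψ, hψ, mψ.coeFn_toLp⟩
    have h0 := K.starProjection_inner_eq_zero (hF.toLp F) _ hmem
    rw [L2.inner_def] at h0
    rw [← h0]
    refine integral_congr_ae ?_
    filter_upwards [mψ.coeFn_toLp, hF.coeFn_toLp, Lp.coeFn_sub (hF.toLp F) v] with x h1 h2 h3
    rw [h1, h3, Pi.sub_apply, h2]

/-! ### The surface measure -/

theorem euclideanHausdorffMeasure_lt_top {X : Type*} [EMetricSpace X] [MeasurableSpace X]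
    [BorelSpace X] {n : ℕ} {s : Set X} (h : (μH[n] : Measure X) s < ⊤) :
    (μHE[n] : Measure X) s < ⊤ := by
  rw [Measure.euclideanHausdorffMeasure_def, Measure.smul_apply, ENNReal.smul_def,
    smul_eq_mul]
  exact ENNReal.mul_lt_top ENNReal.coe_lt_top h

theorem euclideanHausdorffMeasure_pos {X : Type*} [EMetricSpace X] [MeasurableSpace X]
    [BorelSpace X] {n : ℕ} {s : Set X} (h : 0 < (μH[n] : Measure X) s) :
    0 < (μHE[n] : Measure X) s := by
  rw [Measure.euclideanHausdorffMeasure_def, Measure.smul_apply, ENNReal.smul_def,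
    smul_eq_mul]
  refine ENNReal.mul_pos ?_ h.ne'
  exact_mod_cast Measure.addHaarScalarFactor_volume_hausdorffMeasure_ne_zero n

theorem finrank_orthogonal_span_singleton_eq (hd : 1 ≤ d) {e : E d} (he : ‖e‖ = 1) :
    Module.finrank ℝ (ℝ ∙ e)ᗮ = d - 1 := by
  have : Fact (Module.finrank ℝ (E d) = d - 1 + 1) := ⟨by simp; omega⟩
  exact Submodule.finrank_orthogonal_span_singleton (norm_ne_zero_iff.1 (by simp [he]))

theorem inner_eq_of_mem_frontier {D : Set (E d)} {p e : E d} {γ : E d → ℝ} {r : ℝ}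
    (hγ : Continuous γ) (h : ∀ x ∈ Metric.ball p r, (x ∈ D ↔ inner ℝ x e < γ x)) {x : E d}
    (hx : x ∈ frontier D) (hxr : x ∈ Metric.ball p r) : inner ℝ x e = γ x := by
  have hb : Metric.ball p r ∈ 𝓝 x := Metric.isOpen_ball.mem_nhds hxr
  have hi : Continuous fun y : E d => (inner ℝ y e : ℝ) := continuous_id.inner continuous_const
  rw [frontier_eq_closure_inter_closure] at hx
  refine le_antisymm (not_lt.1 fun hlt => ?_) (not_lt.1 fun hlt => ?_)
  · obtain ⟨y, ⟨hy1, hy2⟩, hy⟩ := mem_closure_iff_nhds.1 hx.1 _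
      (inter_mem hb ((isOpen_lt hγ hi).mem_nhds hlt))
    exact lt_asymm hy2 ((h y hy1).1 hy)
  · obtain ⟨y, ⟨hy1, hy2⟩, hy⟩ := mem_closure_iff_nhds.1 hx.2 _
      (inter_mem hb ((isOpen_lt hi hγ).mem_nhds hlt))
    exact hy ((h y hy1).2 hy2)

/-- The graph piece is contained in the image of a ball of the hyperplane `e⊥` under the Lipschitz
map `y ↦ y + γ(y) e`. -/
theorem hausdorffMeasure_graph_lt_top (hd : 1 ≤ d) {e : E d} (he : ‖e‖ = 1) {γ : E d → ℝ} {K : ℝ≥0}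
    (hγ : LipschitzWith K γ) (hinv : ∀ (x : E d) (t : ℝ), γ (x + t • e) = γ x) (p : E d) (r : ℝ) :
    (μH[(d - 1 : ℕ)] : Measure (E d)) {x ∈ Metric.ball p r | inner ℝ x e = γ x} < ⊤ := by
  let S := (ℝ ∙ e)ᗮ
  have hS : Module.finrank ℝ S = d - 1 := finrank_orthogonal_span_singleton_eq hd he
  let T : S → E d := fun y => (y : E d) + γ y • e
  have hT : LipschitzWith (1 + K) T := by
    refine (LipschitzWith.subtype_val _).add (LipschitzWith.of_dist_le_mul fun y z => ?_)
    rw [dist_eq_norm_sub, ← sub_smul, norm_smul, he, mul_one, ← dist_eq_norm_sub]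
    exact hγ.dist_le_mul y z
  have hsub : {x ∈ Metric.ball p r | inner ℝ x e = γ x} ⊆
      T '' Metric.closedBall 0 (‖p‖ + r) := by
    rintro x ⟨hx, hxe⟩
    have hmem : x - γ x • e ∈ S := by
      rw [Submodule.mem_orthogonal_singleton_iff_inner_left, inner_sub_left, inner_smul_left,
        real_inner_self_eq_norm_sq, he, hxe]
      simp
    have hγx : γ (x - γ x • e) = γ x := by
      rw [sub_eq_add_neg, ← neg_smul, hinv]
    refine ⟨⟨x - γ x • e, hmem⟩, ?_, by simp [T, hγx]⟩
    rw [mem_closedBall_zero_iff]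
    have h1 : ‖x - γ x • e‖ ^ 2 ≤ ‖x‖ ^ 2 := by
      rw [norm_sub_sq_real, inner_smul_right, norm_smul, he, hxe, Real.norm_eq_abs, mul_one, sq_abs]
      nlinarith [sq_nonneg (γ x)]
    have h2 : ‖x - γ x • e‖ ≤ ‖x‖ := (sq_le_sq₀ (norm_nonneg _) (norm_nonneg _)).1 h1
    have h3 : ‖x - p‖ < r := by simpa [dist_eq_norm_sub] using hx
    have h4 : ‖x‖ ≤ ‖p‖ + ‖x - p‖ := by simpa using norm_add_le p (x - p)
    simp only [Submodule.coe_norm] at *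
    linarith
  refine (measure_mono hsub).trans_lt
    ((hT.hausdorffMeasure_image_le (Nat.cast_nonneg _) _).trans_lt ?_)
  refine ENNReal.mul_lt_top (by finiteness) ?_
  rw [← hS]
  exact (isCompact_closedBall _ _).measure_lt_top

theorem IsBoundedLipschitzDomain.measure_frontier_lt_top (hd : 1 ≤ d) {D : Set (E d)}
    (hD : IsBoundedLipschitzDomain D) : (μHE[d - 1] : Measure (E d)) (frontier D) < ⊤ := by
  have hc : IsCompact (frontier D) :=
    hD.isBounded.isCompact_closure.of_isClosed_subset isClosed_frontier frontier_subset_closure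
  refine hc.measure_lt_top_of_nhdsWithin fun p hp => ?_
  obtain ⟨e, γ, K, r, he, hγ, hinv, hr, h⟩ := hD.graph p hp
  refine ⟨frontier D ∩ Metric.ball p r, inter_mem self_mem_nhdsWithin
    (mem_nhdsWithin_of_mem_nhds (Metric.ball_mem_nhds p hr)), ?_⟩
  refine (measure_mono ?_).trans_lt
    (euclideanHausdorffMeasure_lt_top (hausdorffMeasure_graph_lt_top hd he hγ hinv p r))
  exact fun x hx => ⟨hx.2, inner_eq_of_mem_frontier hγ.continuous h hx.1 hx.2⟩

/-- Each line parallel to `e` through `U` leaves the bounded set `closure U`, so the projection of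
the frontier along `e` covers that of `U`, a nonempty open subset of a hyperplane; the projection is
1-Lipschitz. The frontier of `closure U` is used because it always lies on `∂ω`, while interior
slits of `∂U` would not. -/
theorem euclideanHausdorffMeasure_frontier_closure_pos (hd : 1 ≤ d) {U : Set (E d)}
    (hU : IsOpen U) (hne : U.Nonempty) (hb : Bornology.IsBounded U) :
    0 < (μHE[d - 1] : Measure (E d)) (frontier (closure U)) := by
  let e : E d := EuclideanSpace.single ⟨0, hd⟩ 1
  have he : ‖e‖ = 1 := by simp [e]
  let S := (ℝ ∙ e)ᗮ
  have hS : Module.finrank ℝ S = d - 1 := finrank_orthogonal_span_singleton_eq hd he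
  let P : E d →L[ℝ] S := S.orthogonalProjectionOnto
  have hP : Function.Surjective P := fun y => ⟨y, by simp [P]⟩
  have hPe : P e = 0 := Submodule.orthogonalProjectionOnto_orthogonalComplement_singleton_eq_zero e
  have hsub : P '' U ⊆ P '' frontier (closure U) := by
    rintro _ ⟨x, hx, rfl⟩
    have hcont : Continuous fun t : ℝ => x + t • e := by fun_prop
    let A : Set ℝ := (fun t : ℝ => x + t • e) ⁻¹' closure U
    have hA : A ≠ univ := fun hA => by
      obtain ⟨C, hC⟩ := hb.closure.exists_norm_le
      have h0 := hC _ (show x + (C + ‖x‖ + 1) • e ∈ closure U from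
        (hA ▸ mem_univ (C + ‖x‖ + 1) : C + ‖x‖ + 1 ∈ A))
      have hC0 : 0 ≤ C := (norm_nonneg x).trans (hC x (subset_closure hx))
      have h1 : ‖(C + ‖x‖ + 1) • e‖ = C + ‖x‖ + 1 := by
        rw [norm_smul, he, mul_one, Real.norm_of_nonneg (by positivity)]
      have h2 := norm_sub_le (x + (C + ‖x‖ + 1) • e) x
      rw [add_sub_cancel_left, h1] at h2
      linarith
    obtain ⟨t, ht⟩ := nonempty_frontier_iff.2
      ⟨⟨0, show x + (0 : ℝ) • e ∈ closure U by simpa using subset_closure hx⟩, hA⟩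
    exact ⟨x + t • e, hcont.frontier_preimage_subset _ ht, by simp [hPe]⟩
  have hopen : IsOpen (P '' U) := P.isOpenMap hP U hU
  have hpos : 0 < (μH[(d - 1 : ℕ)] : Measure S) (P '' U) := by
    rw [← hS]
    exact hopen.measure_pos _ (hne.image P)
  have hlip : LipschitzWith 1 P := S.lipschitzWith_orthogonalProjectionOnto
  refine euclideanHausdorffMeasure_pos (hpos.trans_le ((measure_mono hsub).trans ?_))
  simpa using hlip.hausdorffMeasure_image_le (d := ((d - 1 : ℕ) : ℝ)) (Nat.cast_nonneg _)
    (frontier (closure U))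

/-! ### The boundary of the region between `U` and `Ω` -/

theorem isOpen_obstacle {Ω U : Set (E d)} (hΩ : IsOpen Ω) : IsOpen (obstacle Ω U) :=
  hΩ.sdiff isClosed_closure

theorem frontier_obstacle_subset (Ω U : Set (E d)) :
    frontier (obstacle Ω U) ⊆ frontier Ω ∪ frontier U := by
  rw [obstacle, sdiff_eq]
  refine (frontier_inter_subset _ _).trans ?_
  rw [frontier_compl]
  exact union_subset_union inter_subset_left (inter_subset_right.trans frontier_closure_subset)

theorem frontier_closure_subset_frontier_obstacle {Ω U : Set (E d)} (hΩ : IsOpen Ω)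
    (hU : closure U ⊆ Ω) : frontier (closure U) ⊆ frontier (obstacle Ω U) := by
  intro x hx
  rw [(isOpen_obstacle hΩ).frontier_eq]
  rw [frontier_eq_closure_inter_closure, closure_closure] at hx
  refine ⟨mem_closure_iff_nhds.2 fun t ht => ?_, fun h => h.2 hx.1⟩
  obtain ⟨y, hy, hy'⟩ := mem_closure_iff_nhds.1 hx.2 _
    (inter_mem ht (hΩ.mem_nhds (hU hx.1)))
  exact ⟨y, hy.1, hy.2, hy'⟩

theorem isFiniteMeasure_surfaceMeasure_obstacle (hd : 1 ≤ d) {Ω U : Set (E d)}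
    (hΩ : IsBoundedLipschitzDomain Ω) (hU : IsBoundedLipschitzDomain U) :
    IsFiniteMeasure (surfaceMeasure (obstacle Ω U)) := by
  refine ⟨?_⟩
  rw [surfaceMeasure, Measure.restrict_apply_univ]
  exact (measure_mono (frontier_obstacle_subset Ω U)).trans_lt (measure_union_lt_top
    (hΩ.measure_frontier_lt_top hd) (hU.measure_frontier_lt_top hd))

theorem eLpNorm_indicator_frontier_pos (hd : 1 ≤ d) {Ω U : Set (E d)} (hΩ : IsOpen Ω)
    (hU : IsBoundedLipschitzDomain U) (hUΩ : closure U ⊆ Ω) :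
    0 < eLpNorm ((frontier U).indicator fun _ => (1 : ℝ)) 2 (surfaceMeasure (obstacle Ω U)) := by
  rw [eLpNorm_indicator_const isClosed_frontier.measurableSet (by norm_num) (by norm_num)]
  have h : 0 < surfaceMeasure (obstacle Ω U) (frontier U) := by
    rw [surfaceMeasure, Measure.restrict_apply isClosed_frontier.measurableSet]
    refine (euclideanHausdorffMeasure_frontier_closure_pos hd hU.isOpen hU.nonempty
      hU.isBounded).trans_le (measure_mono ?_)
    exact subset_inter frontier_closure_subset (frontier_closure_subset_frontier_obstacle hΩ hUΩ)
  simp only [enorm_one, one_mul]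
  exact ENNReal.rpow_pos_of_nonneg h (by norm_num)

/-! ### The distance to a domain -/

/-- The point of `closure U` nearest to an exterior point lies on the frontier. Distances to `U` can
therefore replace distances to `∂U` throughout `ω`. -/
theorem infDist_frontier_eq {U : Set (E d)} (hU : U.Nonempty) {x : E d} (hx : x ∉ closure U) :
    Metric.infDist x (frontier U) = Metric.infDist x U := by
  obtain ⟨p, hp, hxp⟩ := exists_mem_frontier_infDist_compl_eq_dist (s := (closure U)ᶜ) hx
    (fun h => by
      obtain ⟨y, hy⟩ := hU
      exact (h ▸ mem_univ y : y ∈ (closure U)ᶜ) (subset_closure hy))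
  rw [compl_compl, Metric.infDist_closure] at hxp
  rw [frontier_compl] at hp
  have hp' : p ∈ frontier U := frontier_closure_subset hp
  refine le_antisymm ((Metric.infDist_le_dist_of_mem hp').trans hxp.ge) ?_
  rw [← Metric.infDist_closure (s := U)]
  exact Metric.infDist_le_infDist_of_subset frontier_subset_closure ⟨p, hp'⟩

theorem exists_pos_infDist_le_subset {U Ω : Set (E d)} (hU : U.Nonempty)
    (hb : Bornology.IsBounded U) (hΩ : IsOpen Ω) (h : closure U ⊆ Ω) :
    ∃ δ : ℝ, 0 < δ ∧ ∀ x, Metric.infDist x U ≤ δ → x ∈ Ω := by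
  obtain ⟨δ, hδ, hs⟩ := hb.isCompact_closure.exists_cthickening_subset_open hΩ h
  refine ⟨δ, hδ, fun x hx => hs ?_⟩
  rw [Metric.cthickening_closure, Metric.mem_cthickening_iff,
    ENNReal.le_ofReal_iff_toReal_le (Metric.infEDist_ne_top hU) hδ.le]
  exact hx

theorem infDist_pos_of_notMem_closure {U : Set (E d)} (hU : U.Nonempty) {x : E d}
    (hx : x ∉ closure U) : 0 < Metric.infDist x U :=
  Metric.infDist_nonneg.lt_of_ne' fun h => hx ((Metric.mem_closure_iff_infDist_zero hU).2 h)

theorem lipschitzWith_mul_of_le_one {f g : E d → ℝ} {K L : ℝ≥0} (hf : LipschitzWith K f)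
    (hg : LipschitzWith L g) (hf1 : ∀ x, |f x| ≤ 1) (hg1 : ∀ x, |g x| ≤ 1) :
    LipschitzWith (K + L) fun x => f x * g x := by
  refine LipschitzWith.of_dist_le_mul fun x y => ?_
  have h1 := hf.dist_le_mul x y
  have h2 := hg.dist_le_mul x y
  rw [Real.dist_eq] at h1 h2 ⊢
  have e : f x * g x - f y * g y = (f x - f y) * g x + f y * (g x - g y) := by ring
  rw [e, NNReal.coe_add, add_mul]
  refine (abs_add_le _ _).trans (add_le_add ?_ ?_)
  · rw [abs_mul]
    exact (mul_le_of_le_one_right (abs_nonneg _) (hg1 x)).trans h1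
  · rw [abs_mul]
    exact (mul_le_of_le_one_left (abs_nonneg _) (hf1 y)).trans h2

/-- The cutoff function with value `1` for `d(x, U) ≤ δ / 2` and `0` for `d(x, U) ≥ δ`. -/
noncomputable def cutoff (U : Set (E d)) (δ : ℝ) (x : E d) : ℝ :=
  max 0 (min 1 (2 - 2 / δ * Metric.infDist x U))

theorem cutoff_nonneg (U : Set (E d)) (δ : ℝ) (x : E d) : 0 ≤ cutoff U δ x := le_max_left _ _

theorem cutoff_le_one (U : Set (E d)) (δ : ℝ) (x : E d) : cutoff U δ x ≤ 1 :=
  max_le zero_le_one (min_le_left _ _)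

theorem cutoff_eq_one {U : Set (E d)} {δ : ℝ} (hδ : 0 < δ) {x : E d}
    (hx : Metric.infDist x U ≤ δ / 2) : cutoff U δ x = 1 := by
  have : 2 / δ * Metric.infDist x U ≤ 2 / δ * (δ / 2) := by gcongr
  have e : 2 / δ * (δ / 2) = 1 := by field_simp
  rw [cutoff, min_eq_left (by linarith), max_eq_right zero_le_one]

theorem cutoff_eq_zero {U : Set (E d)} {δ : ℝ} (hδ : 0 < δ) {x : E d}
    (hx : δ ≤ Metric.infDist x U) : cutoff U δ x = 0 := by
  have : 2 / δ * δ ≤ 2 / δ * Metric.infDist x U := by gcongr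
  have e : 2 / δ * δ = 2 := by field_simp
  rw [cutoff, max_eq_left]
  exact (min_le_right _ _).trans (by linarith)

theorem lipschitzWith_cutoff (U : Set (E d)) {δ : ℝ} (hδ : 0 < δ) :
    LipschitzWith (2 / δ).toNNReal (cutoff U δ) := by
  have h : LipschitzWith (2 / δ).toNNReal fun x => 2 - 2 / δ * Metric.infDist x U := by
    refine LipschitzWith.of_dist_le_mul fun x y => ?_
    rw [Real.coe_toNNReal _ (by positivity), Real.dist_eq]
    have e : 2 - 2 / δ * Metric.infDist x U - (2 - 2 / δ * Metric.infDist y U) =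
        -(2 / δ * (Metric.infDist x U - Metric.infDist y U)) := by ring
    rw [e, abs_neg, abs_mul, abs_of_pos (by positivity)]
    have := (Metric.lipschitz_infDist_pt U).dist_le_mul x y
    rw [NNReal.coe_one, one_mul, Real.dist_eq] at this
    gcongr
  exact (h.const_min 1).const_max 0

/-- The reciprocal `1 / (1 + j d(x, U))`, frozen for `d(x, U) ≥ 1 / √j`. -/
noncomputable def decay (U : Set (E d)) (j : ℕ) (x : E d) : ℝ :=
  (1 + j * min (Metric.infDist x U) (1 / Real.sqrt j))⁻¹

theorem one_le_decay_denominator (U : Set (E d)) (j : ℕ) (x : E d) :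
    1 ≤ 1 + j * min (Metric.infDist x U) (1 / Real.sqrt j) := by
  have : 0 ≤ min (Metric.infDist x U) (1 / Real.sqrt j) :=
    le_min Metric.infDist_nonneg (by positivity)
  have := mul_nonneg (Nat.cast_nonneg (α := ℝ) j) this
  linarith

theorem decay_nonneg (U : Set (E d)) (j : ℕ) (x : E d) : 0 ≤ decay U j x :=
  inv_nonneg.2 (zero_le_one.trans (one_le_decay_denominator U j x))

theorem decay_le_one (U : Set (E d)) (j : ℕ) (x : E d) : decay U j x ≤ 1 :=
  inv_le_one_of_one_le₀ (one_le_decay_denominator U j x)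

theorem decay_of_le {U : Set (E d)} {j : ℕ} {x : E d}
    (hx : Metric.infDist x U ≤ 1 / Real.sqrt j) :
    decay U j x = 1 / (1 + j * Metric.infDist x U) := by
  rw [decay, min_eq_left hx, one_div]

theorem decay_of_ge {U : Set (E d)} {j : ℕ} {x : E d} (hx : 1 / Real.sqrt j ≤ Metric.infDist x U) :
    decay U j x = (1 + Real.sqrt j)⁻¹ := by
  rw [decay, min_eq_right hx, mul_one_div, Real.div_sqrt]

theorem lipschitzWith_decay (U : Set (E d)) (j : ℕ) : LipschitzWith j (decay U j) := by
  refine LipschitzWith.of_dist_le_mul fun x y => ?_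
  have hx := one_le_decay_denominator U j x
  have hy := one_le_decay_denominator U j y
  have hm := ((Metric.lipschitz_infDist_pt U).min_const (1 / Real.sqrt j)).dist_le_mul x y
  rw [NNReal.coe_one, one_mul, Real.dist_eq] at hm
  rw [Real.dist_eq, decay, decay, inv_sub_inv (by linarith) (by linarith), abs_div]
  refine (div_le_self (abs_nonneg _) ?_).trans ?_
  · rw [abs_of_pos (by positivity)]
    exact one_le_mul_of_one_le_of_one_le hx hy
  · have e : 1 + j * min (Metric.infDist y U) (1 / Real.sqrt j) -
        (1 + j * min (Metric.infDist x U) (1 / Real.sqrt j)) =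
        -(j * (min (Metric.infDist x U) (1 / Real.sqrt j) -
          min (Metric.infDist y U) (1 / Real.sqrt j))) := by ring
    rw [e, abs_neg, abs_mul, Nat.abs_cast, NNReal.coe_natCast]
    gcongr

/-- The competitor for the explicit sequence: it agrees with the `j`-th function in `U` and in
the collar, and decays linearly to `0` outside of the collar. -/
noncomputable def competitor (U : Set (E d)) (δ : ℝ) (j : ℕ) (x : E d) : ℝ :=
  cutoff U δ x * decay U j x

theorem lipschitzWith_competitor (U : Set (E d)) {δ : ℝ} (hδ : 0 < δ) (j : ℕ) :
    LipschitzWith ((2 / δ).toNNReal + j) (competitor U δ j) :=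
  lipschitzWith_mul_of_le_one (lipschitzWith_cutoff U hδ) (lipschitzWith_decay U j)
    (fun x => (abs_of_nonneg (cutoff_nonneg U δ x)).trans_le (cutoff_le_one U δ x))
    (fun x => (abs_of_nonneg (decay_nonneg U j x)).trans_le (decay_le_one U j x))

theorem abs_competitor_le (U : Set (E d)) (δ : ℝ) (j : ℕ) (x : E d) :
    |competitor U δ j x| ≤ decay U j x := by
  rw [competitor, abs_of_nonneg (mul_nonneg (cutoff_nonneg U δ x) (decay_nonneg U j x))]
  exact mul_le_of_le_one_left (decay_nonneg U j x) (cutoff_le_one U δ x)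

theorem competitor_eq_zero {U : Set (E d)} {δ : ℝ} (hδ : 0 < δ) (j : ℕ) {x : E d}
    (hx : δ ≤ Metric.infDist x U) : competitor U δ j x = 0 := by
  rw [competitor, cutoff_eq_zero hδ hx, zero_mul]

theorem competitor_eq_one {U : Set (E d)} {δ : ℝ} (hδ : 0 < δ) (j : ℕ) {x : E d}
    (hx : Metric.infDist x U = 0) : competitor U δ j x = 1 := by
  rw [competitor, cutoff_eq_one hδ (by rw [hx]; positivity),
    decay_of_le (by rw [hx]; positivity), hx]
  simp

theorem competitor_of_le {U : Set (E d)} {δ : ℝ} (hδ : 0 < δ) {j : ℕ}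
    (hj : 1 / Real.sqrt j ≤ δ / 2) {x : E d} (hx : Metric.infDist x U ≤ 1 / Real.sqrt j) :
    competitor U δ j x = 1 / (1 + j * Metric.infDist x U) := by
  rw [competitor, cutoff_eq_one hδ (hx.trans hj), decay_of_le hx, one_mul]

theorem isCompact_infDist_le {U Ω : Set (E d)} {δ : ℝ} (hb : Bornology.IsBounded Ω)
    (h : ∀ x, Metric.infDist x U ≤ δ → x ∈ Ω) : IsCompact {x | Metric.infDist x U ≤ δ} :=
  Metric.isCompact_of_isClosed_isBounded
    (isClosed_le (Metric.continuous_infDist_pt U) continuous_const) (hb.subset h)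

theorem tsupport_subset_infDist_le {U : Set (E d)} {δ : ℝ} {f : E d → ℝ}
    (h : ∀ x, δ ≤ Metric.infDist x U → f x = 0) :
    tsupport f ⊆ {x | Metric.infDist x U ≤ δ} := by
  refine closure_minimal (fun x hx => ?_)
    (isClosed_le (Metric.continuous_infDist_pt U) continuous_const)
  exact le_of_not_ge fun h' => hx (h x h')

/-! ### The explicit sequence -/

/-- Beyond the collar `decay` is the constant `(1 + √j)⁻¹`, so only the cutoff, of slope `2 / δ`,
contributes. -/
theorem norm_gradient_competitor_le {U : Set (E d)} {δ : ℝ} (hδ : 0 < δ) {j : ℕ} {W : Set (E d)}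
    (hW : IsOpen W) (h : ∀ x ∈ W, 1 / Real.sqrt j ≤ Metric.infDist x U) {x : E d} (hx : x ∈ W) :
    ‖∇ (competitor U δ j) x‖ ≤ 2 / δ * (1 + Real.sqrt j)⁻¹ := by
  have he : competitor U δ j =ᶠ[𝓝 x] fun y => cutoff U δ y * (1 + Real.sqrt j)⁻¹ := by
    filter_upwards [hW.mem_nhds hx] with y hy
    rw [competitor, decay_of_ge (h y hy)]
  have hl : LipschitzWith (2 / δ * (1 + Real.sqrt j)⁻¹).toNNReal
      fun y => cutoff U δ y * (1 + Real.sqrt j)⁻¹ := by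
    refine LipschitzWith.of_dist_le_mul fun y z => ?_
    have := (lipschitzWith_cutoff U hδ).dist_le_mul y z
    rw [Real.coe_toNNReal _ (by positivity), Real.dist_eq] at this
    rw [Real.coe_toNNReal _ (by positivity), Real.dist_eq, ← sub_mul, abs_mul,
      abs_of_pos (show 0 < (1 + Real.sqrt j)⁻¹ by positivity), mul_right_comm]
    gcongr
  rw [he.gradient_eq]
  refine (LipschitzWith.norm_gradient_le hl x).trans_eq (Real.coe_toNNReal _ (by positivity))

/-- Dominated convergence: a fixed point of `ω` has positive distance to `U`, so for large `j` it
lies beyond the collar, where the value is at most `(1 + √j)⁻¹`. -/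
theorem tendsto_eLpNorm_competitor {U Ω : Set (E d)} (hU : U.Nonempty) (hΩ : IsOpen Ω)
    (hb : Bornology.IsBounded Ω) {δ : ℝ} (hδ : 0 < δ)
    (h : ∀ x, Metric.infDist x U ≤ δ → x ∈ Ω) :
    Tendsto (fun j : ℕ => eLpNorm (competitor U δ j) 2 (volume.restrict (obstacle Ω U)))
      atTop (𝓝 0) := by
  have hs : Tendsto (fun j : ℕ => Real.sqrt j) atTop atTop :=
    Real.tendsto_sqrt_atTop.comp tendsto_natCast_atTop_atTop
  have hs1 : Tendsto (fun j : ℕ => (1 + Real.sqrt j)⁻¹) atTop (𝓝 0) :=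
    (tendsto_const_nhds.add_atTop hs).inv_tendsto_atTop
  have hs2 : Tendsto (fun j : ℕ => 1 / Real.sqrt j) atTop (𝓝 0) :=
    tendsto_const_nhds.div_atTop hs
  refine tendsto_eLpNorm_two_of_dominated (C := 1) (S := Ω) hΩ.measurableSet
    ((Measure.restrict_apply_le _ _).trans_lt hb.measure_lt_top).ne
    (fun j => (lipschitzWith_competitor U hδ j).continuous.aestronglyMeasurable)
    (fun j x => (abs_competitor_le U δ j x).trans (decay_le_one U j x))
    (fun j x hx => competitor_eq_zero hδ j (le_of_not_ge fun h' => hx (h x h'))) ?_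
  filter_upwards [ae_restrict_mem (isOpen_obstacle hΩ).measurableSet] with x hx
  refine squeeze_zero_norm' ?_ hs1
  filter_upwards [hs2.eventually_le_const (infDist_pos_of_notMem_closure hU hx.2)] with j hj
  exact (abs_competitor_le U δ j x).trans_eq (decay_of_ge hj)

/-- On `∂ω` the approximants `φ k - ψ k` reduce to `φ k`, which is uniformly close to the
competitor, and the competitor is `1` on `∂U` and `0` on `∂Ω`. Finiteness of the surface measure
turns this into `L²` convergence. -/
theorem hasTrace_sub {Ω U W : Set (E d)} (hd : 1 ≤ d) (hΩ : IsBoundedLipschitzDomain Ω)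
    (hU : IsBoundedLipschitzDomain U) {δ : ℝ} (hδ : 0 < δ)
    (h : ∀ x, Metric.infDist x U ≤ δ → x ∈ Ω) (hW : W ⊆ obstacle Ω U) {j : ℕ}
    {φ ψ : ℕ → E d → ℝ} {w : E d → ℝ} {v : E d → E d}
    (hφ : ConvergesH1 Ω φ (competitor U δ j) (∇ (competitor U δ j))) {b : ℕ → ℝ}
    (hb : Tendsto b atTop (𝓝 0)) (hφb : ∀ k x, |φ k x - competitor U δ j x| ≤ b k)
    (hψ : ConvergesH1 W ψ w v) :
    HasTrace (obstacle Ω U) (fun x => competitor U δ j x - w x)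
      ((frontier U).indicator fun _ => (1 : ℝ)) := by
  have hfin := isFiniteMeasure_surfaceMeasure_obstacle hd hΩ hU
  have hω : IsOpen (obstacle Ω U) := isOpen_obstacle hΩ.isOpen
  have hc := hφ.sub (hψ.mono (hW.trans sdiff_subset))
  refine ⟨hc.memH1 _, (memLp_const 1).indicator isClosed_frontier.measurableSet,
    fun k x => φ k x - ψ k x, fun k => ⟨(hc.test k).1, (hc.test k).2.1⟩, hc.tendstoH1 hω, ?_⟩
  have hle : ∀ k, eLpNorm (fun x => φ k x - ψ k x - (frontier U).indicator (fun _ => (1 : ℝ)) x) 2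
      (surfaceMeasure (obstacle Ω U)) ≤
      surfaceMeasure (obstacle Ω U) univ ^ (2 : ℝ≥0∞).toReal⁻¹ * ENNReal.ofReal (b k) := by
    intro k
    refine eLpNorm_le_of_ae_bound ?_
    refine (ae_restrict_iff' isClosed_frontier.measurableSet).2 (Eventually.of_forall fun x hx => ?_)
    have hxW : x ∉ W := fun hx' => by
      rw [hω.frontier_eq] at hx
      exact hx.2 (hW hx')
    have hcx : competitor U δ j x = (frontier U).indicator (fun _ => (1 : ℝ)) x := by
      by_cases hxU : x ∈ frontier U
      · rw [indicator_of_mem hxU, competitor_eq_one hδ]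
        exact (Metric.mem_closure_iff_infDist_zero hU.nonempty).1 (frontier_subset_closure hxU)
      · rw [indicator_of_notMem hxU]
        have hxΩ := (frontier_obstacle_subset Ω U hx).resolve_right hxU
        rw [hΩ.isOpen.frontier_eq] at hxΩ
        exact competitor_eq_zero hδ j (le_of_not_ge fun h' => hxΩ.2 (h x h'))
    rw [(hψ.test k).eq_zero hxW, sub_zero, ← hcx]
    exact hφb k x
  have hlim := ENNReal.Tendsto.const_mul (a := surfaceMeasure (obstacle Ω U) univ ^
    (2 : ℝ≥0∞).toReal⁻¹) (ENNReal.tendsto_ofReal hb)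
    (Or.inr (ENNReal.rpow_ne_top_of_nonneg (by positivity) (measure_ne_top _ _)))
  rw [ENNReal.ofReal_zero, mul_zero] at hlim
  exact tendsto_of_tendsto_of_tendsto_of_le_of_le tendsto_const_nhds hlim (fun _ => zero_le) hle

/-- Harmonic replacement of the competitor in `W`. The correction vanishes off `W`, so the values in
`U` and in the collar are untouched. -/
theorem exists_isExplicitFunction (hd : 1 ≤ d) {Ω U : Set (E d)}
    (hΩ : IsBoundedLipschitzDomain Ω) (hU : IsBoundedLipschitzDomain U) {δ R : ℝ} (hδ : 0 < δ)
    (h : ∀ x, Metric.infDist x U ≤ δ → x ∈ Ω) (hR : 0 ≤ R) (hΩR : Ω ⊆ Metric.closedBall 0 R)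
    {j : ℕ} (hj : 1 / Real.sqrt j ≤ δ / 2) :
    ∃ f : E d → ℝ, IsExplicitFunction Ω U j f ∧
      HasTrace (obstacle Ω U) f ((frontier U).indicator fun _ => (1 : ℝ)) ∧
      eLpNorm f 2 (volume.restrict (obstacle Ω U)) ≤
        eLpNorm (competitor U δ j) 2 (volume.restrict (obstacle Ω U)) +
        ENNReal.ofReal (2 * R) * (volume Ω ^ (2 : ℝ≥0∞).toReal⁻¹ *
          ENNReal.ofReal (2 / δ * (1 + Real.sqrt j)⁻¹)) := by
  have hω : IsOpen (obstacle Ω U) := isOpen_obstacle hΩ.isOpen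
  have hlip := lipschitzWith_competitor U hδ j
  have hts := tsupport_subset_infDist_le fun x => competitor_eq_zero (U := U) hδ j (x := x)
  have hcpt : HasCompactSupport (competitor U δ j) :=
    (isCompact_infDist_le hΩ.isBounded h).of_isClosed_subset (isClosed_tsupport _) hts
  obtain ⟨φ, hφ, b, hb, hφb⟩ := exists_convergesH1_of_lipschitz hΩ.isOpen hlip hcpt
    (hts.trans fun x => h x)
  let W : Set (E d) := obstacle Ω U \ closure (collar Ω U j)
  have hWo : IsOpen W := hω.sdiff isClosed_closure
  have hWω : W ⊆ obstacle Ω U := sdiff_subset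
  have hWΩ : W ⊆ Ω := hWω.trans sdiff_subset
  have hWd : ∀ x ∈ W, 1 / Real.sqrt j ≤ Metric.infDist x U := fun x hx => by
    rw [← infDist_frontier_eq hU.nonempty hx.1.2]
    exact le_of_not_gt fun hlt => hx.2 (subset_closure ⟨hx.1, hlt⟩)
  -- Truncating to `W` keeps the steep gradient in the collar out of the bound for the correction;
  -- test functions of `W` do not see the difference.
  let F : E d → E d := W.indicator (∇ (competitor U δ j))
  have hF : MemLp F 2 volume := hφ.memLp_grad.indicator hWo.measurableSet
  obtain ⟨ψ, w, v, hψ, hvF, horth⟩ :=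
    exists_dirichlet_projection hd hR (hWΩ.trans hΩR) hF
  have hc := hφ.sub (hψ.mono hWΩ)
  refine ⟨fun x => competitor U δ j x - w x, ⟨hc.memH10 hΩ.isOpen, ?_, ?_, fun χ hχ => ?_⟩,
    hasTrace_sub hd hΩ hU hδ h hWω hφ hb hφb hψ, ?_⟩
  · have hdisj : Disjoint W U :=
      disjoint_left.2 fun x hx hxU => hx.1.2 (subset_closure hxU)
    filter_upwards [hψ.ae_eq_zero_compl hU.isOpen.measurableSet hdisj,
      ae_restrict_mem hU.isOpen.measurableSet] with x hx hxU
    rw [hx, competitor_eq_one hδ j (Metric.infDist_zero_of_mem hxU), sub_zero]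
  · have hdisj : Disjoint W (collar Ω U j) :=
      disjoint_left.2 fun x hx hxU => hx.2 (subset_closure hxU)
    have hm : MeasurableSet (collar Ω U j) := hω.measurableSet.inter
      (isOpen_lt (Metric.continuous_infDist_pt _) continuous_const).measurableSet
    filter_upwards [hψ.ae_eq_zero_compl hm hdisj, ae_restrict_mem hm] with x hx hxU
    have hx' := hxU.2
    rw [infDist_frontier_eq hU.nonempty hxU.1.2] at hx' ⊢
    rw [hx, competitor_of_le hδ hj hx'.le, sub_zero]
  · have hae := ae_restrict_of_ae_restrict_of_subset (sdiff_subset : obstacle Ω U ⊆ Ω)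
      (hc.weakGrad_ae_eq hΩ.isOpen)
    have e1 : ∫ x in obstacle Ω U,
        inner ℝ (weakGrad Ω (fun x => competitor U δ j x - w x) x) (∇ χ x) =
        ∫ x in obstacle Ω U, inner ℝ (∇ (competitor U δ j) x - v x) (∇ χ x) := by
      refine integral_congr_ae ?_
      filter_upwards [hae] with x hx
      rw [hx]
    rw [e1, setIntegral_eq_integral_of_forall_compl_eq_zero
      (fun x hx => by rw [hχ.gradient_eq_zero fun h' => hx (hWω h'), inner_zero_right]), ← horth χ hχ]
    refine integral_congr_ae (Eventually.of_forall fun x => ?_)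
    by_cases hx : x ∈ W
    · simp only [F, indicator_of_mem hx]
    · simp only [hχ.gradient_eq_zero hx, inner_zero_right]
  · have hFn : eLpNorm F 2 volume ≤ volume Ω ^ (2 : ℝ≥0∞).toReal⁻¹ *
        ENNReal.ofReal (2 / δ * (1 + Real.sqrt j)⁻¹) := by
      rw [eLpNorm_indicator_eq_eLpNorm_restrict hWo.measurableSet]
      refine (eLpNorm_le_of_ae_bound ((ae_restrict_iff' hWo.measurableSet).2
        (Eventually.of_forall fun x hx => norm_gradient_competitor_le hδ hWo hWd hx))).trans ?_
      rw [Measure.restrict_apply_univ]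
      gcongr
    refine (eLpNorm_sub_le hlip.continuous.aestronglyMeasurable
      (hψ.memLp.restrict _).1 (by norm_num)).trans (add_le_add le_rfl ?_)
    refine (eLpNorm_mono_measure _ Measure.restrict_le_self).trans
      ((hψ.eLpNorm_le hd hR (hWΩ.trans hΩR)).trans ?_)
    gcongr
    exact hvF.trans hFn

theorem exists_explicit_sequence (hd : 1 ≤ d) {Ω U : Set (E d)}
    (hU : IsBoundedLipschitzDomain U) (hΩ : IsBoundedLipschitzDomain Ω) (hUΩ : closure U ⊆ Ω) :
    ∃ (J : ℕ) (f : ℕ → E d → ℝ),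
      (∀ j : ℕ, J ≤ j → IsExplicitFunction Ω U j (f j) ∧
        HasTrace (obstacle Ω U) (f j) ((frontier U).indicator fun _ => (1 : ℝ))) ∧
      Tendsto (fun j : ℕ => eLpNorm (f j) 2 (volume.restrict (obstacle Ω U))) atTop (𝓝 0) := by
  obtain ⟨δ, hδ, h⟩ := exists_pos_infDist_le_subset hU.nonempty hU.isBounded hΩ.isOpen hUΩ
  obtain ⟨R, hR, hΩR⟩ : ∃ R : ℝ, 0 ≤ R ∧ Ω ⊆ Metric.closedBall 0 R := by
    obtain ⟨R, hR⟩ := hΩ.isBounded.subset_closedBall 0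
    exact ⟨max R 0, le_max_right _ _, hR.trans (Metric.closedBall_subset_closedBall (le_max_left _ _))⟩
  have hs : Tendsto (fun j : ℕ => Real.sqrt j) atTop atTop :=
    Real.tendsto_sqrt_atTop.comp tendsto_natCast_atTop_atTop
  have hs1 : Tendsto (fun j : ℕ => 2 / δ * (1 + Real.sqrt j)⁻¹) atTop (𝓝 0) := by
    simpa using ((tendsto_const_nhds (x := (1 : ℝ))).add_atTop hs).inv_tendsto_atTop.const_mul
      (2 / δ)
  have hs2 : Tendsto (fun j : ℕ => 1 / Real.sqrt j) atTop (𝓝 0) :=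
    tendsto_const_nhds.div_atTop hs
  obtain ⟨J, hJ⟩ := eventually_atTop.1 (hs2.eventually_le_const (half_pos hδ))
  have hex : ∀ j : ℕ, ∃ f : E d → ℝ, J ≤ j → _ := fun j => by
    by_cases hj : J ≤ j
    · obtain ⟨f, hf⟩ := exists_isExplicitFunction hd hΩ hU hδ h hR hΩR (hJ j hj)
      exact ⟨f, fun _ => hf⟩
    -- An arbitrary value: nothing is claimed below `J`.
    · exact ⟨0, fun h' => absurd h' hj⟩
  choose f hf using hex
  refine ⟨J, f, fun j hj => ⟨(hf j hj).1, (hf j hj).2.1⟩, ?_⟩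
  have hlim : Tendsto (fun j : ℕ =>
      eLpNorm (competitor U δ j) 2 (volume.restrict (obstacle Ω U)) +
        ENNReal.ofReal (2 * R) * (volume Ω ^ (2 : ℝ≥0∞).toReal⁻¹ *
          ENNReal.ofReal (2 / δ * (1 + Real.sqrt j)⁻¹))) atTop
      (𝓝 (0 + ENNReal.ofReal (2 * R) * (volume Ω ^ (2 : ℝ≥0∞).toReal⁻¹ * ENNReal.ofReal 0))) :=
    (tendsto_eLpNorm_competitor hU.nonempty hΩ.isOpen hΩ.isBounded hδ h).add
      (ENNReal.Tendsto.const_mul (ENNReal.Tendsto.const_mul (ENNReal.tendsto_ofReal hs1)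
        (Or.inr (ENNReal.rpow_ne_top_of_nonneg (by positivity) hΩ.isBounded.measure_lt_top.ne)))
        (Or.inr ENNReal.ofReal_ne_top))
  rw [ENNReal.ofReal_zero, mul_zero, mul_zero, add_zero] at hlim
  refine tendsto_of_tendsto_of_tendsto_of_le_of_le' tendsto_const_nhds hlim
    (Eventually.of_forall fun _ => zero_le) ?_
  filter_upwards [eventually_ge_atTop J] with j hj using (hf j hj).2.2

theorem exists_trace_gt (hd : 1 ≤ d) {Ω U : Set (E d)}
    (hU : IsBoundedLipschitzDomain U) (hΩ : IsBoundedLipschitzDomain Ω) (hUΩ : closure U ⊆ Ω)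
    (C : ℝ) : ∃ u g : E d → ℝ, MemH10 Ω u ∧ HasTrace (obstacle Ω U) u g ∧
      ENNReal.ofReal C * eLpNorm u 2 (volume.restrict (obstacle Ω U)) <
        eLpNorm g 2 (surfaceMeasure (obstacle Ω U)) := by
  obtain ⟨J, f, hf, hlim⟩ := exists_explicit_sequence hd hU hΩ hUΩ
  have hlim' := ENNReal.Tendsto.const_mul (a := ENNReal.ofReal C) hlim
    (Or.inr ENNReal.ofReal_ne_top)
  rw [mul_zero] at hlim'
  obtain ⟨j, hj, hJ⟩ := ((hlim'.eventually_lt_const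
    (eLpNorm_indicator_frontier_pos hd hΩ.isOpen hU hUΩ)).and (eventually_ge_atTop J)).exists
  exact ⟨f j, _, (hf j hJ).1.memH10, (hf j hJ).2, hj⟩

/-! ### Lack of coercivity -/

/-- A direction `v` with `v · (x - p) > 0` enters the ball about `x`, hence avoids `U`, so `v · ν <
0` is impossible. One open half-space thus lies in the closed half-space of `ν`, which forces the
unit normals to agree. -/
theorem IsOutwardUnitNormal.eq_of_disjoint_ball {U : Set (E d)} {p ν x : E d}
    (hν : IsOutwardUnitNormal U p ν) (hx : 0 < ‖x - p‖)
    (hU : ∀ y, ‖y - x‖ < ‖x - p‖ → y ∉ U) : ν = ‖x - p‖⁻¹ • (x - p) := by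
  have key : ∀ v : E d, 0 < inner ℝ v (x - p) → 0 ≤ inner ℝ v ν := by
    intro v hv
    by_contra! hneg
    have hv0 : 0 < ‖v‖ := norm_pos_iff.2 fun h => by simp [h] at hv
    -- This aperture is half of `|v · ν| / |v|`, so the ray along `v` lies strictly inside the cone.
    obtain ⟨r, hr, h⟩ := hν.2 (-inner ℝ v ν / (2 * ‖v‖)) (div_pos (neg_pos.2 hneg) (by positivity))
    obtain ⟨s, hs0, hsr, hsq⟩ : ∃ s : ℝ, 0 < s ∧ s * ‖v‖ < r ∧
        s * ‖v‖ ^ 2 < 2 * inner ℝ v (x - p) := by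
      have t1 : Tendsto (fun s : ℝ => s * ‖v‖) (𝓝[>] 0) (𝓝 0) := by
        have : Continuous fun s : ℝ => s * ‖v‖ := by fun_prop
        simpa using (this.tendsto 0).mono_left nhdsWithin_le_nhds
      have t2 : Tendsto (fun s : ℝ => s * ‖v‖ ^ 2) (𝓝[>] 0) (𝓝 0) := by
        have : Continuous fun s : ℝ => s * ‖v‖ ^ 2 := by fun_prop
        simpa using (this.tendsto 0).mono_left nhdsWithin_le_nhds
      obtain ⟨s, h1, h2, h3⟩ := ((eventually_mem_nhdsWithin (a := (0 : ℝ)) (s := Ioi 0)).and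
        ((t1.eventually_lt_const hr).and
          (t2.eventually_lt_const (by positivity : 0 < 2 * inner ℝ v (x - p))))).exists
      exact ⟨s, h1, h2, h3⟩
    have hmem : p + s • v ∈ U := by
      refine (h (p + s • v) ?_).1 ?_
      · simpa [dist_eq_norm_sub, norm_smul, abs_of_pos hs0] using hsr
      · rw [add_sub_cancel_left, inner_smul_left, norm_smul, Real.norm_of_nonneg hs0.le]
        have e : -(-inner ℝ v ν / (2 * ‖v‖) * (s * ‖v‖)) = s * inner ℝ v ν / 2 := by field_simp
        rw [e]
        have : s * inner ℝ v ν < 0 := mul_neg_of_pos_of_neg hs0 hneg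
        simp only [conj_trivial]
        linarith
    refine hU _ ?_ hmem
    have e : p + s • v - x = s • v - (x - p) := by abel
    rw [e]
    refine (sq_lt_sq₀ (norm_nonneg _) (norm_nonneg _)).1 ?_
    rw [norm_sub_sq_real, inner_smul_left, norm_smul, Real.norm_of_nonneg hs0.le]
    simp only [conj_trivial]
    nlinarith
  set m := ‖x - p‖⁻¹ • (x - p) with hm
  have hm1 : ‖m‖ = 1 := by rw [hm, norm_smul, norm_inv, norm_norm, inv_mul_cancel₀ hx.ne']
  have hxm : x - p = ‖x - p‖ • m := by rw [hm, smul_inv_smul₀ hx.ne']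
  have hmm : (inner ℝ m m : ℝ) = 1 := by rw [real_inner_self_eq_norm_sq, hm1, one_pow]
  have hνν : (inner ℝ ν ν : ℝ) = 1 := by rw [real_inner_self_eq_norm_sq, hν.1, one_pow]
  have h1 : 1 ≤ (inner ℝ ν m : ℝ) := by
    by_contra! hlt
    -- If `ν · m < 1`, the vector `m - ν` has positive product with `m` but negative product with
    -- `ν`.
    have := key (m - ν) (by
      rw [hxm, inner_smul_right, inner_sub_left, hmm]
      exact mul_pos hx (by linarith))
    rw [inner_sub_left, hνν, real_inner_comm] at this
    linarith
  have h2 : ‖ν - m‖ ^ 2 ≤ 0 := by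
    rw [norm_sub_sq_real, hm1, hν.1]
    linarith
  exact sub_eq_zero.1 (norm_eq_zero.1 (pow_eq_zero_iff two_ne_zero |>.1
    (le_antisymm h2 (sq_nonneg _))))

/-- The function `max (0, 1 - k d(x, U))`. -/
noncomputable def ramp (U : Set (E d)) (k : ℝ≥0) (x : E d) : ℝ :=
  max 0 (1 - k * Metric.infDist x U)

theorem lipschitzWith_ramp (U : Set (E d)) (k : ℝ≥0) : LipschitzWith k (ramp U k) := by
  have h : LipschitzWith k fun x => 1 - k * Metric.infDist x U := by
    refine LipschitzWith.of_dist_le_mul fun x y => ?_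
    rw [Real.dist_eq]
    have e : 1 - k * Metric.infDist x U - (1 - k * Metric.infDist y U) =
        -(k * (Metric.infDist x U - Metric.infDist y U)) := by ring
    rw [e, abs_neg, abs_mul, NNReal.abs_eq]
    have := (Metric.lipschitz_infDist_pt U).dist_le_mul x y
    rw [NNReal.coe_one, one_mul, Real.dist_eq] at this
    gcongr
  exact h.const_max 0

theorem ramp_nonneg (U : Set (E d)) (k : ℝ≥0) (x : E d) : 0 ≤ ramp U k x := le_max_left _ _

theorem ramp_le_one (U : Set (E d)) (k : ℝ≥0) (x : E d) : ramp U k x ≤ 1 :=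
  max_le zero_le_one (sub_le_self _ (mul_nonneg k.2 Metric.infDist_nonneg))

/-- Moving from `x` towards its nearest point `p`, the distance decreases at exactly unit speed.
Past `x` it need not, so only the left derivative is computed; differentiability at `x` makes it the
full directional derivative. -/
theorem inner_gradient_ramp {U : Set (E d)} {k : ℝ≥0} {x p : E d}
    (hd : DifferentiableAt ℝ (ramp U k) x) (hp : p ∈ closure U)
    (hxp : Metric.infDist x U = ‖x - p‖) (hx : 0 < ‖x - p‖) (hk : k * ‖x - p‖ < 1) :
    inner ℝ (∇ (ramp U k) x) (‖x - p‖⁻¹ • (x - p)) = -k := by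
  set m := ‖x - p‖⁻¹ • (x - p) with hm
  have hm1 : ‖m‖ = 1 := by rw [hm, norm_smul, norm_inv, norm_norm, inv_mul_cancel₀ hx.ne']
  have hdist : ∀ t : ℝ, t < 0 → -‖x - p‖ < t → Metric.infDist (x + t • m) U = ‖x - p‖ + t := by
    intro t ht htx
    refine le_antisymm ?_ ?_
    · rw [← Metric.infDist_closure]
      refine (Metric.infDist_le_dist_of_mem hp).trans_eq ?_
      have e : x + t • m - p = (‖x - p‖ + t) • m := by
        rw [add_smul, hm, smul_inv_smul₀ hx.ne']
        abel
      rw [dist_eq_norm_sub, e, norm_smul, hm1, mul_one, Real.norm_of_nonneg (by linarith)]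
    · have := Metric.infDist_le_infDist_add_dist (s := U) (x := x) (y := x + t • m)
      rw [hxp, dist_eq_norm_sub, sub_add_cancel_left, norm_neg, norm_smul, hm1, mul_one,
        Real.norm_of_nonpos ht.le] at this
      linarith
  have hcurve : HasDerivAt (fun t : ℝ => x + t • m) m 0 := by
    simpa using ((hasDerivAt_id (0 : ℝ)).smul_const m).const_add x
  have h1 : HasDerivAt (fun t : ℝ => ramp U k (x + t • m)) (fderiv ℝ (ramp U k) x m) 0 := by
    have hF : HasFDerivAt (ramp U k) (fderiv ℝ (ramp U k) x) (x + (0 : ℝ) • m) := by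
      simpa using hd.hasFDerivAt
    exact hF.comp_hasDerivAt (0 : ℝ) hcurve
  have h2 : HasDerivWithinAt (fun t : ℝ => ramp U k (x + t • m)) (-k : ℝ) (Iio 0) 0 := by
    have h3 : HasDerivWithinAt (fun t : ℝ => 1 - (k : ℝ) * (‖x - p‖ + t)) (-k : ℝ) (Iio 0) 0 := by
      have := (((hasDerivAt_id (0 : ℝ)).const_add ‖x - p‖).const_mul (k : ℝ)).const_sub 1
      simpa using this.hasDerivWithinAt
    have hpos : 0 ≤ 1 - (k : ℝ) * ‖x - p‖ := by linarith
    refine h3.congr_of_eventuallyEq ?_ ?_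
    · have hmem : Ioo (-‖x - p‖) 0 ∈ 𝓝[<] (0 : ℝ) := Ioo_mem_nhdsLT (by linarith)
      filter_upwards [hmem] with t ht
      rw [ramp, hdist t ht.2 ht.1, max_eq_right]
      have := mul_nonneg k.2 (neg_nonneg.2 ht.2.le)
      have e : 1 - (k : ℝ) * (‖x - p‖ + t) = 1 - k * ‖x - p‖ + k * -t := by ring
      rw [e]
      exact add_nonneg hpos this
    · simp [ramp, hxp, hpos]
  rw [inner_gradient_eq]
  exact (uniqueDiffWithinAt_Iio (0 : ℝ)).eq_deriv _ h1.hasDerivWithinAt h2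

/-- At the nearest point `p` the product with `n p` is exactly `-k`. Since `|x - p| < 1/k ≤ η`,
replacing `n p` by `n x` costs at most `k/2`. -/
theorem inner_gradient_ramp_le {Ω U : Set (E d)} (hU : U.Nonempty) (hΩ : IsOpen Ω)
    (hUΩ : closure U ⊆ Ω) {n : E d → E d} {η : ℝ}
    (hη : ∀ x ∈ closure (obstacle Ω U), ∀ y ∈ closure (obstacle Ω U), dist x y < η →
      dist (n x) (n y) < 1 / 2)
    (hn : ∀ p ∈ frontier U, IsOutwardUnitNormal U p (n p)) {k : ℝ≥0} (hk : 1 ≤ k * η)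
    {x : E d} (hx : x ∈ obstacle Ω U) (hd : DifferentiableAt ℝ (ramp U k) x)
    (hxk : k * Metric.infDist x U < 1) :
    inner ℝ (∇ (ramp U k) x) (n x) ≤ -(k / 2) := by
  obtain ⟨p, hp, hxp⟩ := exists_mem_frontier_infDist_compl_eq_dist (s := (closure U)ᶜ) hx.2
    (fun h => by
      obtain ⟨y, hy⟩ := hU
      exact (h ▸ mem_univ y : y ∈ (closure U)ᶜ) (subset_closure hy))
  rw [compl_compl, Metric.infDist_closure, dist_eq_norm_sub] at hxp
  rw [frontier_compl] at hp
  have hpω := frontier_closure_subset_frontier_obstacle hΩ hUΩ hp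
  have hpU : p ∈ frontier U := frontier_closure_subset hp
  have hpos : 0 < ‖x - p‖ := hxp ▸ infDist_pos_of_notMem_closure hU hx.2
  have hnp : n p = ‖x - p‖⁻¹ • (x - p) := by
    refine (hn p hpU).eq_of_disjoint_ball hpos fun y hy hyU => ?_
    rw [← hxp, ← dist_eq_norm_sub, dist_comm] at hy
    exact not_lt.2 (Metric.infDist_le_dist_of_mem hyU) hy
  have h1 := inner_gradient_ramp hd (frontier_subset_closure hpU) hxp hpos (hxp ▸ hxk)
  have h2 : dist (n x) (n p) < 1 / 2 := by
    refine hη x (subset_closure hx) p (frontier_subset_closure hpω) ?_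
    rw [dist_eq_norm_sub, ← hxp]
    exact lt_of_mul_lt_mul_left (hxk.trans_le hk) k.2
  have h3 : inner ℝ (∇ (ramp U k) x) (n x - n p) ≤ (k : ℝ) * (1 / 2) := by
    refine (real_inner_le_norm _ _).trans ?_
    rw [← dist_eq_norm_sub]
    exact mul_le_mul (LipschitzWith.norm_gradient_le (lipschitzWith_ramp U k) x) h2.le
      dist_nonneg k.2
  have e : n x = n p + (n x - n p) := by abel
  rw [e, inner_add_right, hnp, h1, ← hnp]
  linarith

theorem not_isCoerciveForm {Ω U : Set (E d)} {n : E d → E d} {α ε : ℝ} {u : E d → ℝ}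
    (hu : MemH10 Ω u) (h : penalizedForm Ω U n α ε u u < 0) : ¬ IsCoerciveForm Ω U n α ε := by
  rintro ⟨c, hc, hle⟩
  have h1 : 0 ≤ h1NormSq Ω u := integral_nonneg fun x => by positivity
  exact not_lt.2 ((mul_nonneg hc.le h1).trans (hle u hu)) h

theorem exists_forall_not_isCoerciveForm {Ω U : Set (E d)} {n : E d → E d} {α : ℝ} {u : E d → ℝ}
    (hu : MemH10 Ω u)
    (h : ∫ x in obstacle Ω U, (inner ℝ (weakGrad Ω u x) (n x) * u x + α * u x * u x) < 0) :
    ∃ ε₀ : ℝ, 0 < ε₀ ∧ ∀ ε : ℝ, 0 < ε → ε < ε₀ → ¬ IsCoerciveForm Ω U n α ε := by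
  set B := ∫ x in obstacle Ω U, (inner ℝ (weakGrad Ω u x) (n x) * u x + α * u x * u x) with hB
  set A := ∫ x in Ω, (inner ℝ (weakGrad Ω u x) (weakGrad Ω u x) + u x * u x) with hA
  have hA0 : 0 ≤ A := integral_nonneg fun x =>
    add_nonneg real_inner_self_nonneg (mul_self_nonneg _)
  -- The form is `A + B/ε`; the `+ 1` makes the denominator positive even if `A = 0`.
  refine ⟨-B / (A + 1), div_pos (neg_pos.2 h) (by linarith), fun ε hε hlt => ?_⟩
  refine not_isCoerciveForm hu ?_
  rw [penalizedForm, ← hA, ← hB]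
  rw [lt_div_iff₀ (by linarith)] at hlt
  have h2 : A < -B / ε := by
    rw [lt_div_iff₀ hε]
    nlinarith
  have h3 : 1 / ε * B = -(-B / ε) := by ring
  rw [h3]
  linarith

theorem exists_forall_not_isCoerciveForm_of_normal {Ω U : Set (E d)} {n : E d → E d} {α : ℝ}
    (hU : IsOpen U) (hne : U.Nonempty) (hΩ : IsOpen Ω) (hΩb : Bornology.IsBounded Ω)
    (hUΩ : closure U ⊆ Ω) (hn : ContinuousOn n (closure (obstacle Ω U)))
    (hnormal : ∀ p ∈ frontier U, IsOutwardUnitNormal U p (n p)) (hd : 1 ≤ d) (hα : 0 ≤ α) :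
    ∃ ε₀ : ℝ, 0 < ε₀ ∧ ∀ ε : ℝ, 0 < ε → ε < ε₀ → ¬ IsCoerciveForm Ω U n α ε := by
  have hω : IsOpen (obstacle Ω U) := isOpen_obstacle hΩ
  have hωb : Bornology.IsBounded (obstacle Ω U) := hΩb.subset sdiff_subset
  have hcl : IsCompact (closure (obstacle Ω U)) := hωb.isCompact_closure
  have hUb : Bornology.IsBounded U := hΩb.subset (subset_closure.trans hUΩ)
  obtain ⟨δ, hδ, hsub⟩ := exists_pos_infDist_le_subset hne hUb hΩ hUΩ
  obtain ⟨η, hη0, hη⟩ := Metric.uniformContinuousOn_iff.1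
    (hcl.uniformContinuousOn_of_continuous hn) (1 / 2) (by norm_num)
  -- The three bounds give, in turn, `-k/2 + α ≤ -1`, near constancy of `n` between `x` and its
  -- nearest point on the support, and compact support in `Ω`.
  let k : ℝ≥0 := (max (2 * α + 2) (max (1 / η) (1 / δ))).toNNReal
  have hk : (k : ℝ) = max (2 * α + 2) (max (1 / η) (1 / δ)) :=
    Real.coe_toNNReal _ ((by linarith : (0 : ℝ) ≤ 2 * α + 2).trans (le_max_left _ _))
  have hkα : 2 * α + 2 ≤ k := hk ▸ le_max_left _ _
  have hkη : 1 ≤ k * η := (div_le_iff₀ hη0).1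
    (hk ▸ (le_max_left _ _).trans (le_max_right _ _))
  have hkδ : 1 ≤ k * δ := (div_le_iff₀ hδ).1
    (hk ▸ (le_max_right _ _).trans (le_max_right _ _))
  have hk0 : (0 : ℝ) < k := by linarith
  have hlip := lipschitzWith_ramp U k
  have hzero : ∀ x, δ ≤ Metric.infDist x U → ramp U k x = 0 := fun x hx => by
    have : (k : ℝ) * δ ≤ k * Metric.infDist x U := by gcongr
    exact max_eq_left (by linarith)
  have hts := tsupport_subset_infDist_le hzero
  have hcpt : HasCompactSupport (ramp U k) :=
    (isCompact_infDist_le hΩb hsub).of_isClosed_subset (isClosed_tsupport _) hts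
  obtain ⟨φ, hφ, -⟩ := exists_convergesH1_of_lipschitz hΩ hlip hcpt (hts.trans fun x => hsub x)
  refine exists_forall_not_isCoerciveForm (hφ.memH10 hΩ) ?_
  have hgrad : weakGrad Ω (ramp U k) =ᵐ[volume.restrict (obstacle Ω U)] ∇ (ramp U k) :=
    ae_restrict_of_ae_restrict_of_subset sdiff_subset (hφ.weakGrad_ae_eq hΩ)
  have hdiff : ∀ᵐ x ∂(volume.restrict (obstacle Ω U)), DifferentiableAt ℝ (ramp U k) x :=
    ae_restrict_of_ae hlip.ae_differentiableAt
  have hfin : IsFiniteMeasure (volume.restrict (obstacle Ω U)) :=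
    ⟨by simpa using hωb.measure_lt_top⟩
  obtain ⟨N, hN⟩ := hcl.exists_bound_of_continuousOn hn
  have hnm : AEStronglyMeasurable n (volume.restrict (obstacle Ω U)) :=
    (hn.mono subset_closure).aestronglyMeasurable hω.measurableSet
  have hru : Integrable (ramp U k) (volume.restrict (obstacle Ω U)) :=
    Integrable.of_bound hlip.continuous.aestronglyMeasurable 1
      (Eventually.of_forall fun x => by
        rw [Real.norm_of_nonneg (ramp_nonneg U k x)]; exact ramp_le_one U k x)
  have hint : Integrable (fun x => inner ℝ (∇ (ramp U k) x) (n x) * ramp U k x +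
      α * ramp U k x * ramp U k x) (volume.restrict (obstacle Ω U)) := by
    have i1 : Integrable (fun x => inner ℝ (∇ (ramp U k) x) (n x))
        (volume.restrict (obstacle Ω U)) := by
      refine Integrable.of_bound
        ((measurable_gradient _).aestronglyMeasurable.inner hnm) (k * N) ?_
      filter_upwards [ae_restrict_mem hω.measurableSet] with x hx
      refine (norm_inner_le_norm _ _).trans ?_
      exact mul_le_mul (LipschitzWith.norm_gradient_le hlip x) (hN x (subset_closure hx))
        (norm_nonneg _) k.2
    have hb : ∀ᵐ x ∂(volume.restrict (obstacle Ω U)), ‖ramp U k x‖ ≤ 1 :=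
      Eventually.of_forall fun x => by
        rw [Real.norm_of_nonneg (ramp_nonneg U k x)]; exact ramp_le_one U k x
    exact (i1.mul_bdd hlip.continuous.aestronglyMeasurable hb).add
      ((hru.const_mul α).mul_bdd hlip.continuous.aestronglyMeasurable hb)
  have hle : ∫ x in obstacle Ω U, (inner ℝ (weakGrad Ω (ramp U k) x) (n x) * ramp U k x +
      α * ramp U k x * ramp U k x) ≤ ∫ x in obstacle Ω U, -ramp U k x := by
    rw [integral_congr_ae (g := fun x => inner ℝ (∇ (ramp U k) x) (n x) * ramp U k x +
      α * ramp U k x * ramp U k x) (by filter_upwards [hgrad] with x hx; rw [hx])]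
    refine integral_mono_ae hint hru.neg ?_
    filter_upwards [hdiff, ae_restrict_mem hω.measurableSet] with x hx hxω
    have h0 := ramp_nonneg U k x
    have h1 := ramp_le_one U k x
    by_cases hxk : k * Metric.infDist x U < 1
    · have := inner_gradient_ramp_le hne hΩ hUΩ hη hnormal hkη hxω hx hxk
      have h2 : inner ℝ (∇ (ramp U k) x) (n x) * ramp U k x ≤ -(k / 2) * ramp U k x := by gcongr
      have h3 : α * ramp U k x * ramp U k x ≤ α * ramp U k x :=
        mul_le_of_le_one_right (mul_nonneg hα h0) h1
      have h4 : (2 * α + 2) * ramp U k x ≤ k * ramp U k x := by gcongr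
      show _ ≤ -ramp U k x
      linarith
    · have hz : ramp U k x = 0 := max_eq_left (by linarith)
      simp [hz]
  refine hle.trans_lt ?_
  rw [integral_neg, neg_lt_zero,
    integral_pos_iff_support_of_nonneg (fun x => ramp_nonneg U k x) hru]
  have hso : IsOpen (Function.support (ramp U k)) :=
    isOpen_ne_fun hlip.continuous continuous_const
  rw [Measure.restrict_apply hso.measurableSet]
  refine (hso.inter hω).measure_pos _ ?_
  -- Strictness: the positive measure serves only to supply a point of `∂ω` where the ramp equals
  -- `1`; its open support then meets `ω`.
  have hpos := euclideanHausdorffMeasure_frontier_closure_pos hd hU hne hUb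
  obtain ⟨p, hp⟩ := nonempty_of_measure_ne_zero hpos.ne'
  have hpω := frontier_closure_subset_frontier_obstacle hΩ hUΩ hp
  have hps : p ∈ Function.support (ramp U k) := by
    have h0 : Metric.infDist p U = 0 := (Metric.mem_closure_iff_infDist_zero hne).1
      (frontier_subset_closure (frontier_closure_subset hp))
    simp [ramp, h0]
  exact mem_closure_iff.1 (frontier_subset_closure hpω) _ hso hps

/-! ### Concentric balls -/

/-- Both roots are at least `R/2`, so their sum is at least `a + b`; compare with the difference of
squares. -/
theorem abs_sqrt_sub_sq_sub_le {R a b : ℝ} (ha : 0 ≤ a) (ha' : a ≤ R / 2) (hb : 0 ≤ b)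
    (hb' : b ≤ R / 2) (hR : 0 < R) :
    |Real.sqrt (R ^ 2 - a ^ 2) - Real.sqrt (R ^ 2 - b ^ 2)| ≤ |a - b| := by
  have hlow : ∀ c, 0 ≤ c → c ≤ R / 2 → R / 2 ≤ Real.sqrt (R ^ 2 - c ^ 2) := fun c hc hc' =>
    Real.le_sqrt_of_sq_le (by nlinarith)
  have h1 := hlow a ha ha'
  have h2 := hlow b hb hb'
  have s1 := Real.sq_sqrt (show 0 ≤ R ^ 2 - a ^ 2 by nlinarith)
  have s2 := Real.sq_sqrt (show 0 ≤ R ^ 2 - b ^ 2 by nlinarith)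
  set A := Real.sqrt (R ^ 2 - a ^ 2)
  set B := Real.sqrt (R ^ 2 - b ^ 2)
  have e : (A - B) * (A + B) = -((a - b) * (a + b)) := by ring_nf; linarith
  have e' : |A - B| * (A + B) = |a - b| * (a + b) := by
    have := congrArg abs e
    rwa [abs_neg, abs_mul, abs_mul, abs_of_nonneg (by linarith : 0 ≤ A + B),
      abs_of_nonneg (by linarith : 0 ≤ a + b)] at this
  have h3 : |a - b| * (a + b) ≤ |a - b| * (A + B) := by
    gcongr <;> linarith
  exact le_of_mul_le_mul_right (e'.trans_le h3) (by linarith)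

theorem norm_sub_inner_smul_sq {e : E d} (he : ‖e‖ = 1) (x : E d) :
    ‖x - inner ℝ x e • e‖ ^ 2 = ‖x‖ ^ 2 - inner ℝ x e ^ 2 := by
  rw [norm_sub_sq_real, inner_smul_right, norm_smul, he, Real.norm_eq_abs, mul_one, sq_abs]
  ring

theorem norm_sub_inner_smul_le {e : E d} (he : ‖e‖ = 1) (x : E d) :
    ‖x - inner ℝ x e • e‖ ≤ ‖x‖ := by
  refine (sq_le_sq₀ (norm_nonneg _) (norm_nonneg _)).1 ?_
  rw [norm_sub_inner_smul_sq he]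
  linarith [sq_nonneg (inner ℝ x e : ℝ)]

/-- Near `p` the sphere is the graph of `√(R² - s²)` over the radial direction `p / R`, where `s` is
the distance to the axis. Truncating `s` at `R/2` makes this function globally 1-Lipschitz and
changes nothing within `R/2` of `p`. -/
theorem isBoundedLipschitzDomain_ball {R : ℝ} (hR : 0 < R) :
    IsBoundedLipschitzDomain (Metric.ball (0 : E d) R) := by
  refine ⟨Metric.isOpen_ball, ⟨0, Metric.mem_ball_self hR⟩, Metric.isBounded_ball, fun p hp => ?_⟩
  have hpR : ‖p‖ = R := by simpa using Metric.frontier_ball_subset_sphere hp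
  set e : E d := R⁻¹ • p with he_def
  have he : ‖e‖ = 1 := by
    rw [he_def, norm_smul, hpR, norm_inv, Real.norm_of_nonneg hR.le, inv_mul_cancel₀ hR.ne']
  have hpe : p = R • e := by rw [he_def, smul_inv_smul₀ hR.ne']
  have hee : (inner ℝ e e : ℝ) = 1 := by rw [real_inner_self_eq_norm_sq, he, one_pow]
  let s : E d → ℝ := fun x => min ‖x - inner ℝ x e • e‖ (R / 2)
  have hs0 : ∀ x, 0 ≤ s x := fun x => le_min (norm_nonneg _) (by positivity)
  have hs1 : ∀ x, s x ≤ R / 2 := fun x => min_le_right _ _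
  have hsl : LipschitzWith 1 s := by
    refine LipschitzWith.min_const (LipschitzWith.of_dist_le_mul fun x y => ?_) _
    rw [NNReal.coe_one, one_mul, Real.dist_eq, dist_eq_norm_sub]
    refine (abs_norm_sub_norm_le _ _).trans ?_
    have e1 : x - inner ℝ x e • e - (y - inner ℝ y e • e) =
        (x - y) - inner ℝ (x - y) e • e := by
      rw [inner_sub_left, sub_smul]
      abel
    rw [e1]
    exact norm_sub_inner_smul_le he _
  refine ⟨e, fun x => Real.sqrt (R ^ 2 - s x ^ 2), 1, R / 2, he, ?_, fun x t => ?_, by positivity,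
    fun x hx => ?_⟩
  · refine LipschitzWith.of_dist_le_mul fun x y => ?_
    exact (abs_sqrt_sub_sq_sub_le (hs0 x) (hs1 x) (hs0 y) (hs1 y) hR).trans (hsl.dist_le_mul x y)
  · have e1 : x + t • e - inner ℝ (x + t • e) e • e = x - inner ℝ x e • e := by
      rw [inner_add_left, inner_smul_left, hee, add_smul]
      simp
    simp only [s, e1]
  · rw [Metric.mem_ball, dist_eq_norm_sub] at hx
    have e1 : x - inner ℝ x e • e = (x - p) - inner ℝ (x - p) e • e := by
      rw [inner_sub_left, hpe, inner_smul_left, hee, sub_smul]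
      simp
    have h1 : ‖x - inner ℝ x e • e‖ ≤ ‖x - p‖ := by
      rw [e1]
      exact norm_sub_inner_smul_le he _
    have hsx : s x = ‖x - inner ℝ x e • e‖ := min_eq_left (by linarith)
    have h2 : 0 < (inner ℝ x e : ℝ) := by
      have h3 := abs_real_inner_le_norm (x - p) e
      rw [he, mul_one, inner_sub_left, hpe, inner_smul_left, hee, ← hpe] at h3
      have h4 := (abs_le.1 h3).1
      simp only [conj_trivial, mul_one] at h4
      linarith
    show _ ↔ inner ℝ x e < Real.sqrt (R ^ 2 - s x ^ 2)
    rw [mem_ball_zero_iff, hsx, norm_sub_inner_smul_sq he, Real.lt_sqrt h2.le,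
      ← sq_lt_sq₀ (norm_nonneg _) hR.le]
    constructor <;> intro h <;> linarith

theorem isOutwardUnitNormal_ball {p : E d} (hp : ‖p‖ = 1) :
    IsOutwardUnitNormal (Metric.ball (0 : E d) 1) p p := by
  -- In the inner cone `|x|² < 1 - 2c|x - p| + |x - p|²`, which is at most `1` as long as `|x - p| <
  -- 2c`.
  refine ⟨hp, fun c hc => ⟨2 * c, by positivity, fun x hx => ?_⟩⟩
  rw [Metric.mem_ball, dist_eq_norm_sub] at hx
  have e : ‖x‖ ^ 2 = 1 + 2 * inner ℝ (x - p) p + ‖x - p‖ ^ 2 := by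
    conv_lhs => rw [show x = p + (x - p) by abel]
    rw [norm_add_sq_real, hp, real_inner_comm]
    ring
  rw [mem_ball_zero_iff]
  have h0 := norm_nonneg (x - p)
  constructor
  · intro h
    by_contra! h1
    nlinarith
  · intro h h1
    have := mul_nonneg hc.le h0
    nlinarith [norm_nonneg x]

theorem memLp_of_continuous_of_isBounded {F : Type*} [NormedAddCommGroup F] {D : Set (E d)}
    (hD : Bornology.IsBounded D) (hDm : MeasurableSet D) {g : E d → F} (hg : Continuous g)
    (p : ℝ≥0∞) : MemLp g p (volume.restrict D) := by
  have hfin : IsFiniteMeasure (volume.restrict D) := ⟨by simpa using hD.measure_lt_top⟩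
  obtain ⟨C, hC⟩ := hD.isCompact_closure.exists_bound_of_continuousOn hg.continuousOn
  refine MemLp.of_bound hg.aestronglyMeasurable C ?_
  filter_upwards [ae_restrict_mem hDm] with x hx using hC x (subset_closure hx)

theorem memH1_of_contDiff {D : Set (E d)} (hD : Bornology.IsBounded D) (hDm : MeasurableSet D)
    {f : E d → ℝ} (hf : ContDiff ℝ ∞ f) : MemH1 D f := by
  refine ⟨∇ f, memLp_of_continuous_of_isBounded hD hDm hf.continuous 2,
    memLp_of_continuous_of_isBounded hD hDm (continuous_gradient hf) 2, fun φ hφ => ?_⟩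
  rw [setIntegral_eq_integral_of_forall_compl_eq_zero (f := fun x => f x • ∇ φ x)
      (fun x hx => by rw [hφ.gradient_eq_zero hx, smul_zero]),
    setIntegral_eq_integral_of_forall_compl_eq_zero (f := fun x => φ x • ∇ f x)
      (fun x hx => by rw [hφ.eq_zero hx, zero_smul]),
    integral_smul_gradient_eq_neg hf hφ.1 hφ.2.1]

theorem exists_lipschitz_domains_not_isCoerciveForm (hd : 1 ≤ d) :
    ∃ (U Ω : Set (E d)) (n : E d → E d),
      IsBoundedLipschitzDomain U ∧ IsConnected U ∧ IsBoundedLipschitzDomain Ω ∧ IsConnected Ω ∧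
      closure U ⊆ Ω ∧ (∀ i : Fin d, MemH1 (obstacle Ω U) fun x => n x i) ∧
      MemLp n (d : ℝ≥0∞) (volume.restrict (obstacle Ω U)) ∧
      ContinuousOn n (closure (obstacle Ω U)) ∧
      (∀ p ∈ frontier U, IsOutwardUnitNormal U p (n p)) ∧
      ∀ α : ℝ, 0 ≤ α → ∃ ε₀ : ℝ, 0 < ε₀ ∧ ∀ ε : ℝ, 0 < ε → ε < ε₀ →
        ¬ IsCoerciveForm Ω U n α ε := by
  have h1 := isBoundedLipschitzDomain_ball (d := d) one_pos
  have h2 := isBoundedLipschitzDomain_ball (d := d) two_pos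
  have hsub : closure (Metric.ball (0 : E d) 1) ⊆ Metric.ball 0 2 :=
    Metric.closure_ball_subset_closedBall.trans
      (Metric.closedBall_subset_ball (by norm_num))
  have hω : MeasurableSet (obstacle (Metric.ball (0 : E d) 2) (Metric.ball 0 1)) :=
    (isOpen_obstacle h2.isOpen).measurableSet
  have hωb : Bornology.IsBounded (obstacle (Metric.ball (0 : E d) 2) (Metric.ball 0 1)) :=
    h2.isBounded.subset sdiff_subset
  have hnormal : ∀ p ∈ frontier (Metric.ball (0 : E d) 1),
      IsOutwardUnitNormal (Metric.ball 0 1) p p := fun p hp =>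
    isOutwardUnitNormal_ball (by simpa using Metric.frontier_ball_subset_sphere hp)
  refine ⟨Metric.ball 0 1, Metric.ball 0 2, fun x => x, h1,
    ⟨h1.nonempty, (convex_ball _ _).isPreconnected⟩, h2,
    ⟨h2.nonempty, (convex_ball _ _).isPreconnected⟩, hsub, fun i => ?_,
    memLp_of_continuous_of_isBounded hωb hω continuous_id _, continuousOn_id, hnormal, fun α hα => ?_⟩
  · exact memH1_of_contDiff hωb hω (EuclideanSpace.proj i : E d →L[ℝ] ℝ).contDiff
  · exact exists_forall_not_isCoerciveForm_of_normal h1.isOpen h1.nonempty h2.isOpen h2.isBounded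
      hsub continuousOn_id hnormal hd hα

end Penalization

/-! ### The three statements combined -/

theorem mainTheorem6 (d : ℕ) (hd : 2 ≤ d) :
    -- the explicit sequence, and the trace is not controlled by the `L²(ω)` norm
    (∀ U Ω : Set (Penalization.E d),
      Penalization.IsBoundedLipschitzDomain U → Penalization.IsBoundedLipschitzDomain Ω →
      closure U ⊆ Ω →
      (∃ (J : ℕ) (f : ℕ → Penalization.E d → ℝ),
        (∀ j : ℕ, J ≤ j →
          Penalization.IsExplicitFunction Ω U j (f j) ∧
          Penalization.HasTrace (Penalization.obstacle Ω U) (f j)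
            ((frontier U).indicator fun _ => (1 : ℝ))) ∧
        Tendsto (fun j : ℕ => eLpNorm (f j) 2 (volume.restrict (Penalization.obstacle Ω U)))
          atTop (𝓝 0)) ∧
      (∀ C : ℝ, 0 < C → ∃ u g : Penalization.E d → ℝ,
        Penalization.MemH10 Ω u ∧
        Penalization.HasTrace (Penalization.obstacle Ω U) u g ∧
        ENNReal.ofReal C * eLpNorm u 2 (volume.restrict (Penalization.obstacle Ω U)) <
          eLpNorm g 2 (Penalization.surfaceMeasure (Penalization.obstacle Ω U)))) ∧
    -- non-coercivity for a continuous lifting of the outward unit normal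
    (∀ (U Ω : Set (Penalization.E d)) (n : Penalization.E d → Penalization.E d) (α : ℝ),
      Penalization.IsBoundedLipschitzDomain U → Penalization.IsBoundedLipschitzDomain Ω →
      closure U ⊆ Ω →
      ContinuousOn n (closure (Penalization.obstacle Ω U)) →
      (∀ p ∈ frontier U, Penalization.IsOutwardUnitNormal U p (n p)) →
      0 ≤ α →
      ∃ ε₀ : ℝ, 0 < ε₀ ∧ ∀ ε : ℝ, 0 < ε → ε < ε₀ →
        ¬ Penalization.IsCoerciveForm Ω U n α ε) ∧
    -- in every dimension there are data for which coercivity fails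
    (∃ (U Ω : Set (Penalization.E d)) (n : Penalization.E d → Penalization.E d),
      Penalization.IsBoundedLipschitzDomain U ∧ IsConnected U ∧
      Penalization.IsBoundedLipschitzDomain Ω ∧ IsConnected Ω ∧
      closure U ⊆ Ω ∧
      (∀ i : Fin d, Penalization.MemH1 (Penalization.obstacle Ω U) fun x => n x i) ∧
      MemLp n (d : ℝ≥0∞) (volume.restrict (Penalization.obstacle Ω U)) ∧
      ContinuousOn n (closure (Penalization.obstacle Ω U)) ∧
      (∀ p ∈ frontier U, Penalization.IsOutwardUnitNormal U p (n p)) ∧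
      ∀ α : ℝ, 0 ≤ α → ∃ ε₀ : ℝ, 0 < ε₀ ∧ ∀ ε : ℝ, 0 < ε → ε < ε₀ →
        ¬ Penalization.IsCoerciveForm Ω U n α ε) := by
  have hd1 : 1 ≤ d := one_le_two.trans hd
  refine ⟨fun U Ω hU hΩ hUΩ => ⟨Penalization.exists_explicit_sequence hd1 hU hΩ hUΩ,
    fun C _ => Penalization.exists_trace_gt hd1 hU hΩ hUΩ C⟩, ?_,
    Penalization.exists_lipschitz_domains_not_isCoerciveForm hd1⟩
  intro U Ω n α hU hΩ hUΩ hn hnormal hα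
  exact Penalization.exists_forall_not_isCoerciveForm_of_normal hU.isOpen hU.nonempty hΩ.isOpen
    hΩ.isBounded hUΩ hn hnormal hd1 hα
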